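/- Let $d\ge 1$, let $\mathbb T^d=\mathbb R^d/2\pi\mathbb Z^d$ with normalized Lebesgue measure $\sigma$, let $L_p=L_p(\mathbb T^d,\sigma)$, $1\le p\le\infty$, be the space of complex-valued functions with its usual norm $\|\cdot\|_p$, and let $\widehat f_{\mathbf k}=\int_{\mathbb T^d} f(\mathbf x)e^{-i(\mathbf k,\mathbf x)}\,d\sigma(\mathbf x)$, $\mathbf k\in\mathbb Z^d$, be the Fourier coefficients of $f\in L_1$. Put $|\mathbf k|_1=\sum_j|k_j|$. Let $Y\subset\mathbb Z^d$ be the set of all $\mathbf k$ whose coordinates are all nonnegative or all negative, and let $L_{p,Y}(\mathbb T^d)$ be the set of all $f\in L_p$ with $\widehat f_{\mathbf k}=0$ for $\mathbf k\notin Y$. For $r\in\mathbb N$, $0\le\varrho<1$ and $f\in L_1$ put $$A_{\varrho,r}(f)(\mathbf x)=\sum_{\nu=0}^\infty\lambda_{\nu,r}(\varrho)\sum_{|\mathbf k|_1=\nu}\widehat f_{\mathbf k}e^{i(\mathbf k,\mathbf x)},\qquad \lambda_{\nu,r}(\varrho)=\begin{cases}1,&\nu<r,\\ \sum_{j=0}^{r-1}\binom{\nu}{j}(1-\varrho)^j\varrho^{\nu-j},&\nu\ge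 r.\end{cases}$$ For an integer $m\ge 0$ and $f\in L_1$, the radial derivative $f^{[m]}$ is the function $g\in L_1$ (if it exists) with $\widehat g_{\mathbf k}=0$ if $|\mathbf k|_1<m$ and $\widehat g_{\mathbf k}=\frac{\nu!}{(\nu-m)!}\widehat f_{\mathbf k}$ if $|\mathbf k|_1=\nu\ge m$; in particular $f^{[0]}=f$. For $n\in\mathbb N$ and $\delta>0$ let $$K_n(\delta,f)_p=\inf\{\|f-h\|_p+\delta^n\|h^{[n]}\|_p:\ h\in L_p,\ h^{[n]}\in L_p\}.$$ **Theorem.** Let $1\le p\le\infty$, $f\in L_{p,Y}(\mathbb T^d)$, and let $n,r\in\mathbb N$ be positive integers with $n\le r$. Let $\omega:[0,1]\to\mathbb R$ be continuous and nondecreasing on $[0,1]$, with $\omega(t)\ne0$ for $t\in(0,1]$ and $\omega(t)\to0$ as $t\to0+$, and suppose that $\omega$ satisfies the Zygmund condition $$\int_0^\delta\frac{\omega(t)}{t}\,dt=O(\omega(\delta)),\qquad\delta\to0+$$ (in particular, the integral converges). If $f^{[r-n]}$ exists and belongs to $L_p$ and $$K_n(\delta,f^{[r-n]})_p=O(\omega(\delta)),\qquad\delta\to0+,$$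 then $$\|f-A_{\varrho,r}(f)\|_p=O\big((1-\varrho)^{r-n}\,\omega(1-\varrho)\big),\qquad\varrho\to1-.$$ -/

import Mathlib

open MeasureTheory Filter Set Topology
open scoped ENNReal Nat

noncomputable section

namespace TaylorAbelPoisson

instance fact_two_pi_pos : Fact (0 < 2 * Real.pi) := ⟨Real.two_pi_pos⟩

/-- The torus `𝕋ᵈ = ℝᵈ / 2πℤᵈ`. -/
abbrev Torus (d : ℕ) : Type := Fin d → AddCircle (2 * Real.pi)

/-- The normalized Lebesgue measure on the torus (total mass one). -/
def sigma (d : ℕ) : Measure (Torus d) :=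
  Measure.pi fun _ => (AddCircle.haarAddCircle : Measure (AddCircle (2 * Real.pi)))

/-- The characters `e_k(x) = exp(i (k, x))`, `k ∈ ℤᵈ`. -/
def char {d : ℕ} (k : Fin d → ℤ) (x : Torus d) : ℂ := ∏ j, fourier (k j) (x j)

/-- The Fourier coefficients `∫ f conj(e_k) dσ`. -/
def coeff {d : ℕ} (f : Torus d → ℂ) (k : Fin d → ℤ) : ℂ :=
  ∫ x, f x * (starRingEnd ℂ) (char k x) ∂(sigma d)

/-- `|k|₁ = |k₁| + … + |k_d|`. -/
def l1 {d : ℕ} (k : Fin d → ℤ) : ℕ := ∑ j, (k j).natAbs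

/-- The finite set of all `k ∈ ℤᵈ` with `|k|₁ = ν`. -/
def sphere (d ν : ℕ) : Finset (Fin d → ℤ) :=
  (Fintype.piFinset fun _ => Finset.Icc (-(ν : ℤ)) (ν : ℤ)).filter fun k => l1 k = ν

theorem mem_sphere {d ν : ℕ} (k : Fin d → ℤ) : k ∈ sphere d ν ↔ l1 k = ν := by
  simp only [sphere, Finset.mem_filter, Fintype.mem_piFinset, Finset.mem_Icc,
    and_iff_right_iff_imp]
  intro h j
  have h1 : (k j).natAbs ≤ l1 k :=
    Finset.single_le_sum (f := fun i => (k i).natAbs) (fun i _ => Nat.zero_le _)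
      (Finset.mem_univ j)
  omega

/-- The set `Y` of the `k ∈ ℤᵈ` whose coordinates are all nonnegative or all negative. -/
def Y (d : ℕ) : Set (Fin d → ℤ) := {k | ∀ j, 0 ≤ k j} ∪ {k | ∀ j, k j < 0}

/-- `f ∈ L_{p,Y}(𝕋ᵈ)`: `f ∈ L_p(𝕋ᵈ)` and the Fourier coefficients of `f` vanish off `Y`. -/
def MemLpY {d : ℕ} (f : Torus d → ℂ) (p : ℝ≥0∞) : Prop :=
  MemLp f p (sigma d) ∧ ∀ k, k ∉ Y d → coeff f k = 0

/-- The numbers `λ_{ν,r}(ρ)`. -/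
def lam (ν r : ℕ) (ρ : ℝ) : ℝ :=
  if ν < r then 1
  else ∑ j ∈ Finset.range r, (ν.choose j : ℝ) * (1 - ρ) ^ j * ρ ^ (ν - j)

/-- The Taylor–Abel–Poisson mean `A_{ρ,r}(f)`. -/
def tapMean {d : ℕ} (ρ : ℝ) (r : ℕ) (f : Torus d → ℂ) (x : Torus d) : ℂ :=
  ∑' ν : ℕ, (lam ν r ρ : ℂ) * ∑ k ∈ sphere d ν, coeff f k * char k x

/-- `g ∈ L₁` is the radial derivative `f^{[n]}` of order `n` of `f ∈ L₁`.
For `n = 0` this says that `g = f` almost everywhere. -/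
def IsRadialDeriv {d : ℕ} (n : ℕ) (f g : Torus d → ℂ) : Prop :=
  Integrable f (sigma d) ∧ Integrable g (sigma d) ∧
    ∀ k : Fin d → ℤ, coeff g k =
      if l1 k < n then 0 else (((l1 k)! : ℂ) / ((l1 k - n)! : ℂ)) * coeff f k

/-- The `K`-functional
`K_n(δ, f)_p = inf {‖f - h‖_p + δⁿ ‖h^{[n]}‖_p : h^{[n]} ∈ L_p}`, with values in `[0, ∞]`;
here `g` stands for `h^{[n]}`. -/
def kFunctional {d : ℕ} (n : ℕ) (δ : ℝ) (f : Torus d → ℂ) (p : ℝ≥0∞) : ℝ≥0∞ :=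
  ⨅ (h : Torus d → ℂ) (g : Torus d → ℂ) (_ : MemLp h p (sigma d))
    (_ : IsRadialDeriv n h g) (_ : MemLp g p (sigma d)),
    eLpNorm (f - h) p (sigma d) + ENNReal.ofReal (δ ^ n) * eLpNorm g p (sigma d)

/-- Conditions 1)–4) on a function `ω` on `[0, 1]`
(values of `ω` outside `[0, 1]` are irrelevant). -/
structure IsMajorant (ω : ℝ → ℝ) : Prop where
  continuousOn : ContinuousOn ω (Icc 0 1)
  monotoneOn : MonotoneOn ω (Icc 0 1)
  ne_zero : ∀ t ∈ Ioc (0 : ℝ) 1, ω t ≠ 0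
  tendsto_zero : Tendsto ω (𝓝[>] 0) (𝓝 0)

/-- The Zygmund condition `∫₀^δ ω(t)/t dt = O(ω(δ))`, `δ → 0+`
(including that the integral converges). -/
def ZygmundCondition (ω : ℝ → ℝ) : Prop :=
  (∀ᶠ δ in 𝓝[>] (0 : ℝ), IntegrableOn (fun t => ω t / t) (Ioc 0 δ)) ∧
    (fun δ : ℝ => ∫ t in Ioc 0 δ, ω t / t) =O[𝓝[>] 0] ω

end TaylorAbelPoisson

end

/-!
# Approximation by Taylor–Abel–Poisson means

Let `F(z) = ∑ zᵛ S_ν`, where `S_ν` is the part of the Fourier series of `f` on `|k|₁ = ν`; for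
`0 ≤ ρ < 1` this is the Poisson integral of `f`. The binomial theorem shows (`tapMean_eq_sum`) that
`A_{ρ,r}(f)` is the value at `1` of the Taylor polynomial of `F` of degree `r - 1` about `ρ`. Hence
`f - A_{ρ,r}(f)` is a Taylor remainder, and, with `F` regarded as a function with values in `L_p`,
```
‖f - A_{ρ,r}(f)‖ ≤ ∫_ρ^1 (1 - ζ)^{r-1} ‖F⁽ʳ⁾(ζ)‖ dζ .
```
The Zygmund condition turns a bound `‖F⁽ʳ⁾(ζ)‖ = O(ω(1 - ζ) / (1 - ζ)ⁿ)` into the assertion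
(`norm_powerSum_sub_taylor_le`).

For that bound (`exists_eventually_norm_powerSum_derivCoeff_le`) put `m = r - n`, `g = f^{[m]}`, so
that `F⁽ᵐ⁾(z) = z⁻ᵐ ∑ zᵛ S_ν(g)`, and split `g = (g - h) + h` with `h` almost minimal in the
`K`-functional.

* The Poisson kernel with complex parameter `z`, `|z - ζ| ≤ (1 - ζ) / 2`, is dominated pointwise by
  `12ᵈ` times the positive kernel with parameter `ζ` (`norm_poisson_le`), and averaging against the
  latter is a contraction of `L_p`. So Poisson integrals are bounded in `L_p` on these discs, and
  Cauchy's estimate yields `C (1 - ζ)⁻ⁿ ‖g - h‖` for the contribution of `g - h`.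
* The derivative of order `n` of the Poisson integral of `h` is, up to the factor `ζⁿ`, the Poisson
  integral of `h^{[n]}`; lower derivatives follow by integration, and the factor `z⁻ᵐ` is dealt with
  by the Leibniz rule. This yields `C (‖h‖ + ‖h^{[n]}‖)`.

The term `‖h‖ ≤ ‖g‖ + ‖g - h‖` is harmless: unless all coefficients of `g` of order at least `n`
vanish, in which case `F⁽ʳ⁾ = 0`, the `K`-functional and hence `ω(δ)` is at least of the size `δⁿ`.

The passage from radii `R < 1` to `f` itself uses that Poisson integrals converge to `f` almost
everywhere along a sequence, and Fatou's lemma; this covers `p = ∞` as well.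
-/

noncomputable section

namespace TaylorAbelPoisson

/-! ### Power series with Banach-space coefficients on the unit disc -/

section PowerSeries

variable {E : Type*} [NormedAddCommGroup E]

/-- The coefficients `b` define a power series converging absolutely in the open unit disc. -/
def GeomSummable (b : ℕ → E) : Prop :=
  ∀ t : ℝ, 0 ≤ t → t < 1 → Summable fun ν => t ^ ν * ‖b ν‖

theorem GeomSummable.sub {a b : ℕ → E} (ha : GeomSummable a) (hb : GeomSummable b) :
    GeomSummable (a - b) := by
  intro t h0 h1
  refine Summable.of_nonneg_of_le (fun ν => by positivity) (fun ν => ?_)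
    ((ha t h0 h1).add (hb t h0 h1))
  rw [← mul_add, Pi.sub_apply]
  gcongr
  exact norm_sub_le _ _

theorem summable_natCast_mul_geometric {b : ℕ → E} (hb : GeomSummable b) {t : ℝ} (h0 : 0 ≤ t)
    (h1 : t < 1) : Summable fun ν : ℕ => (ν : ℝ) * t ^ (ν - 1) * ‖b ν‖ := by
  -- Compare with `∑ sᵛ ‖b ν‖` for some `t < s < 1`, using `ν (t / s)ᵛ → 0`.
  obtain ⟨s, hts, hs1⟩ := exists_between h1
  have hs0 : 0 < s := h0.trans_lt hts
  have hq : Summable fun ν : ℕ => (ν : ℝ) ^ 1 * (t / s) ^ ν :=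
    summable_pow_mul_geometric_of_norm_lt_one 1 (by
      rw [Real.norm_of_nonneg (div_nonneg h0 hs0.le), div_lt_one hs0]; exact hts)
  have hlim := hq.tendsto_atTop_zero
  by_cases ht : t = 0
  · subst ht
    refine summable_of_ne_finset_zero (s := {1}) fun ν hν => ?_
    rcases Nat.eq_zero_or_pos ν with h | h
    · simp [h]
    · have : ν - 1 ≠ 0 := by simp at hν; omega
      simp [this]
  have ht0 : 0 < t := lt_of_le_of_ne h0 (Ne.symm ht)
  refine summable_of_isBigO_nat (hb s hs0.le hs1) ?_
  refine Asymptotics.IsBigO.of_bound (1 / t) ?_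
  filter_upwards [hlim.eventually (gt_mem_nhds one_pos)] with ν hν
  rw [pow_one, div_pow, ← mul_div_assoc, div_lt_one (pow_pos hs0 _)] at hν
  rw [Real.norm_of_nonneg (by positivity), Real.norm_of_nonneg (by positivity)]
  rcases Nat.eq_zero_or_pos ν with h | h
  · subst h; simp only [Nat.cast_zero, zero_mul]; positivity
  · have : t ^ ν = t ^ (ν - 1) * t := by rw [← pow_succ]; congr 1; omega
    rw [this] at hν
    rw [← mul_assoc]
    refine mul_le_mul_of_nonneg_right ?_ (norm_nonneg _)
    rw [one_div, ← div_eq_inv_mul, le_div_iff₀ ht0, mul_assoc]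
    exact hν.le

variable [NormedSpace ℂ E]

/-- The sum `∑ zᵛ b_ν` of a power series with vector coefficients. -/
def powerSum (b : ℕ → E) (z : ℂ) : E := ∑' ν, z ^ ν • b ν

/-- The coefficients of the `j`-th derivative of `∑ zᵛ b_ν`. -/
def derivCoeff (j : ℕ) (b : ℕ → E) (ν : ℕ) : E := (((ν + j).descFactorial j : ℕ) : ℂ) • b (ν + j)

theorem derivCoeff_zero (b : ℕ → E) : derivCoeff 0 b = b := by
  ext ν; simp [derivCoeff]

theorem derivCoeff_succ (j : ℕ) (b : ℕ → E) :
    derivCoeff (j + 1) b = derivCoeff 1 (derivCoeff j b) := by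
  ext ν
  simp only [derivCoeff, smul_smul]
  rw [show ν + (j + 1) = ν + 1 + j by ring, Nat.descFactorial_succ,
    show ν + 1 + j - j = ν + 1 by omega]
  simp

theorem GeomSummable.derivCoeff_one {b : ℕ → E} (hb : GeomSummable b) :
    GeomSummable (derivCoeff 1 b) := by
  intro t h0 h1
  have := (summable_nat_add_iff 1).2 (summable_natCast_mul_geometric hb h0 h1)
  refine this.congr fun ν => ?_
  simp only [derivCoeff, Nat.descFactorial_one, norm_smul, Complex.norm_natCast]
  simp only [Nat.add_sub_cancel]
  ring

theorem GeomSummable.derivCoeff {b : ℕ → E} (hb : GeomSummable b) (j : ℕ) :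
    GeomSummable (derivCoeff j b) := by
  induction j with
  | zero => rwa [derivCoeff_zero]
  | succ j ih => rw [derivCoeff_succ]; exact ih.derivCoeff_one

variable [CompleteSpace E]

theorem GeomSummable.summable {b : ℕ → E} (hb : GeomSummable b) {z : ℂ} (hz : ‖z‖ < 1) :
    Summable fun ν => z ^ ν • b ν := by
  refine Summable.of_norm ((hb ‖z‖ (norm_nonneg z) hz).congr fun ν => ?_)
  rw [norm_smul, norm_pow]

theorem powerSum_sub {a b : ℕ → E} (ha : GeomSummable a) (hb : GeomSummable b) {z : ℂ}
    (hz : ‖z‖ < 1) : powerSum (a - b) z = powerSum a z - powerSum b z := by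
  rw [powerSum, powerSum, powerSum, ← (ha.summable hz).tsum_sub (hb.summable hz)]
  simp [smul_sub]

theorem map_powerSum {F : Type*} [NormedAddCommGroup F] [NormedSpace ℂ F] (L : E →L[ℂ] F)
    {b : ℕ → E} (hb : GeomSummable b) {z : ℂ} (hz : ‖z‖ < 1) :
    L (powerSum b z) = powerSum (fun ν => L (b ν)) z := by
  rw [powerSum, L.map_tsum (hb.summable hz)]
  simp [powerSum]

theorem hasDerivAt_powerSum {b : ℕ → E} (hb : GeomSummable b) {z : ℂ} (hz : ‖z‖ < 1) :
    HasDerivAt (powerSum b) (powerSum (derivCoeff 1 b) z) z := by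
  obtain ⟨t, hzt, ht1⟩ := exists_between hz
  have ht0 : 0 < t := (norm_nonneg z).trans_lt hzt
  have h := hasDerivAt_tsum_of_isPreconnected (𝕜 := ℂ)
    (g := fun ν z => z ^ ν • b ν) (g' := fun ν z => ((ν : ℂ) * z ^ (ν - 1)) • b ν)
    (summable_natCast_mul_geometric hb ht0.le ht1) (t := Metric.ball (0 : ℂ) t) (y₀ := z) (y := z)
    Metric.isOpen_ball (convex_ball _ _).isPreconnected
    (fun ν y _ => (hasDerivAt_pow ν y).smul_const (b ν))
    (fun ν y hy => by
      rw [norm_smul, norm_mul, norm_pow, Complex.norm_natCast]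
      have : ‖y‖ ≤ t := by simpa using (mem_ball_zero_iff.1 hy).le
      gcongr)
    (by simpa using hzt) (hb.summable hz) (by simpa using hzt)
  refine h.congr_deriv ?_
  have hs : Summable fun ν : ℕ => ((ν : ℂ) * z ^ (ν - 1)) • b ν := by
    refine Summable.of_norm
      ((summable_natCast_mul_geometric hb (norm_nonneg z) hz).congr fun ν => ?_)
    rw [norm_smul, norm_mul, norm_pow, Complex.norm_natCast]
  rw [hs.tsum_eq_zero_add, powerSum]
  simp only [Nat.cast_zero, zero_mul, zero_smul, zero_add]
  refine tsum_congr fun ν => ?_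
  simp [derivCoeff, smul_smul, mul_comm]

theorem hasDerivAt_powerSum_derivCoeff {b : ℕ → E} (hb : GeomSummable b) (j : ℕ) {z : ℂ}
    (hz : ‖z‖ < 1) :
    HasDerivAt (powerSum (derivCoeff j b)) (powerSum (derivCoeff (j + 1) b) z) z := by
  rw [derivCoeff_succ]
  exact hasDerivAt_powerSum (hb.derivCoeff j) hz

theorem differentiableOn_powerSum {b : ℕ → E} (hb : GeomSummable b) :
    DifferentiableOn ℂ (powerSum b) (Metric.ball 0 1) := fun _ hz =>
  (hasDerivAt_powerSum hb (by simpa using hz)).differentiableAt.differentiableWithinAt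

theorem iteratedDeriv_powerSum_derivCoeff {b : ℕ → E} (hb : GeomSummable b) (m n : ℕ) {z : ℂ}
    (hz : ‖z‖ < 1) :
    iteratedDeriv n (powerSum (derivCoeff m b)) z = powerSum (derivCoeff (m + n) b) z := by
  induction n generalizing z with
  | zero => simp
  | succ n ih =>
    rw [iteratedDeriv_succ]
    have : iteratedDeriv n (powerSum (derivCoeff m b)) =ᶠ[𝓝 z]
        powerSum (derivCoeff (m + n) b) := by
      filter_upwards [Metric.isOpen_ball.mem_nhds
        (show z ∈ Metric.ball (0 : ℂ) 1 by simpa using hz)] with w hw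
      exact ih (by simpa using hw)
    rw [this.deriv_eq, (hasDerivAt_powerSum_derivCoeff hb _ hz).deriv, add_assoc]

theorem iteratedDeriv_powerSum {b : ℕ → E} (hb : GeomSummable b) (n : ℕ) {z : ℂ}
    (hz : ‖z‖ < 1) : iteratedDeriv n (powerSum b) z = powerSum (derivCoeff n b) z := by
  simpa [derivCoeff_zero] using iteratedDeriv_powerSum_derivCoeff hb 0 n hz

/-- Multiplying the `ν`-th coefficient by `ν! / (ν - m)!` amounts to applying `zᵐ (d/dz)ᵐ`. -/
theorem powerSum_eq_pow_smul {a b : ℕ → E} {m : ℕ} (hb : GeomSummable b)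
    (hab : ∀ ν, a ν = ((ν.descFactorial m : ℕ) : ℂ) • b ν) {z : ℂ} (hz : ‖z‖ < 1) :
    powerSum a z = z ^ m • powerSum (derivCoeff m b) z := by
  have hs : Summable fun ν => z ^ (ν + m) • a (ν + m) := by
    refine (((hb.derivCoeff m).summable hz).const_smul (z ^ m)).congr fun ν => ?_
    rw [hab, derivCoeff, smul_smul, pow_add, mul_comm]
  have hs' : Summable fun ν => z ^ ν • a ν := (summable_nat_add_iff m).1 hs
  rw [powerSum, ← hs'.sum_add_tsum_nat_add m, powerSum, ← tsum_const_smul'' (z ^ m)]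
  rw [Finset.sum_eq_zero, zero_add]
  · refine tsum_congr fun ν => ?_
    rw [hab, derivCoeff, smul_smul (z ^ m), pow_add, mul_comm]
  · intro ν hν
    rw [hab, Nat.descFactorial_eq_zero_iff_lt.2 (Finset.mem_range.1 hν)]
    simp

/-- The derivative in the base point `t` of the Taylor polynomial at `R`; integrating it from `ρ`
to `R` gives Taylor's formula. -/
theorem hasDerivAt_taylor_powerSum {b : ℕ → E} (hb : GeomSummable b) (r : ℕ) (R : ℝ) {t : ℝ}
    (h0 : 0 ≤ t) (h1 : t < 1) :
    HasDerivAt (fun t : ℝ => ∑ j ∈ Finset.range (r + 1),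
        ((R - t : ℂ) ^ j / (j ! : ℂ)) • powerSum (derivCoeff j b) (t : ℂ))
      (((R - t : ℂ) ^ r / (r ! : ℂ)) • powerSum (derivCoeff (r + 1) b) (t : ℂ)) t := by
  have hz : ‖(t : ℂ)‖ < 1 := by rw [Complex.norm_real, Real.norm_of_nonneg h0]; exact h1
  have hD (j : ℕ) : HasDerivAt (fun t : ℝ => powerSum (derivCoeff j b) (t : ℂ))
      (powerSum (derivCoeff (j + 1) b) (t : ℂ)) t := by
    simpa [Function.comp_def] using HasDerivAt.scomp t (hasDerivAt_powerSum_derivCoeff hb j hz)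
      Complex.ofRealCLM.hasDerivAt
  induction r with
  | zero => simpa using hD 0
  | succ r ih =>
    simp_rw [Finset.sum_range_succ _ (r + 1)]
    have hc : HasDerivAt (fun t : ℝ => (R - t : ℂ) ^ (r + 1) / ((r + 1)! : ℂ))
        (-((R - t : ℂ) ^ r / (r ! : ℂ))) t := by
      have h2 : HasDerivAt (fun z : ℂ => (R - z : ℂ) ^ (r + 1) / ((r + 1)! : ℂ))
          (-((R - t : ℂ) ^ r / (r ! : ℂ))) (t : ℂ) := by
        refine ((((hasDerivAt_id (t : ℂ)).const_sub (R : ℂ)).pow (r + 1)).div_const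
          ((r + 1)! : ℂ)).congr_deriv ?_
        have : ((r : ℂ) + 1) ≠ 0 := Nat.cast_add_one_ne_zero r
        have : (r ! : ℂ) ≠ 0 := by exact_mod_cast r.factorial_ne_zero
        simp only [Nat.factorial_succ, id]
        push_cast
        field_simp
      exact h2.comp_ofReal
    refine (ih.add (hc.smul (hD (r + 1)))).congr_deriv ?_
    rw [neg_smul]
    abel

end PowerSeries

/-! ### Derivative estimates near the boundary point `1` -/

section Stolz

/-- A Stolz-type approach region at the boundary point `1`: the union of the closed discs
centred at `ζ ∈ [0, 1)` with radius `(1 - ζ) / 2`. -/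
def stolz : Set ℂ := {z | ∃ ζ : ℝ, 0 ≤ ζ ∧ ζ < 1 ∧ ‖z - ζ‖ ≤ (1 - ζ) / 2}

theorem ofReal_mem_stolz {ζ : ℝ} (h0 : 0 ≤ ζ) (h1 : ζ < 1) : (ζ : ℂ) ∈ stolz :=
  ⟨ζ, h0, h1, by simp; linarith⟩

theorem norm_lt_one_of_mem_stolz {z : ℂ} (hz : z ∈ stolz) : ‖z‖ < 1 := by
  obtain ⟨ζ, h0, h1, h⟩ := hz
  have := norm_le_norm_add_norm_sub' z (ζ : ℂ)
  rw [Complex.norm_real, Real.norm_of_nonneg h0] at this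
  linarith

theorem quarter_le_norm {ζ : ℝ} (h0 : 1 / 2 ≤ ζ) {z : ℂ} {s : ℝ} (hs : s ≤ 1 / 4)
    (h : ‖z - ζ‖ ≤ s) : 1 / 4 ≤ ‖z‖ := by
  have := norm_le_norm_add_norm_sub' (ζ : ℂ) z
  rw [Complex.norm_real, Real.norm_of_nonneg (by linarith), norm_sub_rev] at this
  linarith

theorem norm_inv_pow_le (m : ℕ) {z : ℂ} (h : 1 / 4 ≤ ‖z‖) : ‖(z ^ m)⁻¹‖ ≤ 4 ^ m := by
  rw [norm_inv, norm_pow, ← inv_pow]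
  refine pow_le_pow_left₀ (by positivity) ?_ m
  exact inv_le_of_inv_le₀ (by norm_num) (by norm_num; linarith)

theorem norm_iteratedDeriv_inv_pow_le (m i : ℕ) {ζ : ℝ} (h0 : 1 / 2 ≤ ζ) :
    ‖iteratedDeriv i (fun z : ℂ => (z ^ m)⁻¹) ζ‖ ≤ i ! * 4 ^ m / (1 / 4) ^ i := by
  refine Complex.norm_iteratedDeriv_le_of_forall_mem_sphere_norm_le i (by norm_num) ?_ ?_
  · refine DifferentiableOn.diffContOnCl fun z hz => ?_
    rw [closure_ball _ (by norm_num), mem_closedBall_iff_norm] at hz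
    have : z ≠ 0 := by
      rw [← norm_pos_iff]; linarith [quarter_le_norm h0 le_rfl hz]
    exact ((differentiableAt_id.pow m).inv (pow_ne_zero m this)).differentiableWithinAt
  · intro z hz
    exact norm_inv_pow_le m (quarter_le_norm h0 le_rfl (mem_sphere_iff_norm.1 hz).le)

variable {E : Type*} [NormedAddCommGroup E] [NormedSpace ℂ E] [CompleteSpace E]

/-- Cauchy's estimate on the circle of radius `(1 - ζ) / 2`, on which `‖z‖ ≥ 1/4`. -/
theorem norm_iteratedDeriv_inv_pow_smul_le {b : ℕ → E} (hb : GeomSummable b) (m n : ℕ) {M : ℝ}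
    (hM : ∀ z ∈ stolz, ‖powerSum b z‖ ≤ M) {ζ : ℝ} (h0 : 1 / 2 ≤ ζ) (h1 : ζ < 1) :
    ‖iteratedDeriv n (fun z : ℂ => (z ^ m)⁻¹ • powerSum b z) ζ‖ ≤
      n ! * (4 ^ m * M) / ((1 - ζ) / 2) ^ n := by
  have hmem {z : ℂ} (hz : ‖z - ζ‖ ≤ (1 - ζ) / 2) : z ∈ stolz := ⟨ζ, by linarith, h1, hz⟩
  refine Complex.norm_iteratedDeriv_le_of_forall_mem_sphere_norm_le n (by linarith) ?_ ?_
  · refine DifferentiableOn.diffContOnCl fun z hz => ?_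
    rw [closure_ball _ (by linarith), mem_closedBall_iff_norm] at hz
    have : z ≠ 0 := by
      rw [← norm_pos_iff]; linarith [quarter_le_norm h0 (by linarith) hz]
    exact (((differentiableAt_id.pow m).inv (pow_ne_zero m this)).smul
      (hasDerivAt_powerSum hb (norm_lt_one_of_mem_stolz (hmem hz))).differentiableAt)
      |>.differentiableWithinAt
  · intro z hz
    have hz' := (mem_sphere_iff_norm.1 hz).le
    rw [norm_smul]
    exact mul_le_mul (norm_inv_pow_le m (quarter_le_norm h0 (by linarith) hz')) (hM z (hmem hz'))
      (norm_nonneg _) (by positivity)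

/-- Intermediate derivatives on the radius are controlled by the function and the highest
derivative, through the mean value inequality on `[1/2, ζ]`. -/
theorem norm_powerSum_derivCoeff_intermediate_le {b : ℕ → E} (hb : GeomSummable b) {n : ℕ}
    {M M' : ℝ} (hM : ∀ z ∈ stolz, ‖powerSum b z‖ ≤ M)
    (hM' : ∀ ζ : ℝ, 1 / 2 ≤ ζ → ζ < 1 → ‖powerSum (derivCoeff n b) ζ‖ ≤ M')
    (k : ℕ) {i : ℕ} (hi : i + k = n) {ζ : ℝ} (h0 : 1 / 2 ≤ ζ) (h1 : ζ < 1) :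
    ‖powerSum (derivCoeff i b) ζ‖ ≤ M' + k * (n ! * 4 ^ n * M) := by
  have hM0 : 0 ≤ M := (norm_nonneg _).trans (hM 0 ⟨0, le_rfl, one_pos, by norm_num⟩)
  induction k generalizing i ζ with
  | zero => simpa [← hi] using hM' ζ h0 h1
  | succ k ih =>
    have hB := fun {t : ℝ} (ht0 : 1 / 2 ≤ t) (ht1 : t < 1) =>
      ih (i := i + 1) (by omega) (ζ := t) ht0 ht1
    -- At the left end point Cauchy's estimate applies with radius `1/4`.
    have hstart : ‖powerSum (derivCoeff i b) ((1 / 2 : ℝ) : ℂ)‖ ≤ n ! * 4 ^ n * M := by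
      have h := norm_iteratedDeriv_inv_pow_smul_le hb 0 i hM (ζ := 1 / 2) le_rfl (by norm_num)
      simp only [pow_zero, inv_one, one_smul, one_mul] at h
      rw [iteratedDeriv_powerSum hb i (by
        rw [Complex.norm_real, Real.norm_of_nonneg] <;> norm_num)] at h
      refine h.trans ?_
      rw [show ((1 - 1 / 2 : ℝ) / 2) = 4⁻¹ by norm_num, inv_pow, div_inv_eq_mul, mul_right_comm]
      have : (i ! : ℝ) ≤ n ! := by exact_mod_cast Nat.factorial_le (by omega)
      have : (4 : ℝ) ^ i ≤ 4 ^ n := pow_le_pow_right₀ (by norm_num) (by omega)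
      gcongr
    have hmv := norm_image_sub_le_of_norm_deriv_le_segment'
      (f := fun t : ℝ => powerSum (derivCoeff i b) (t : ℂ))
      (f' := fun t : ℝ => powerSum (derivCoeff (i + 1) b) (t : ℂ)) (a := 1 / 2) (b := ζ)
      (C := M' + k * (n ! * 4 ^ n * M))
      (fun t ht => by
        have hz : ‖(t : ℂ)‖ < 1 := by
          rw [Complex.norm_real, Real.norm_of_nonneg (by linarith [ht.1])]; linarith [ht.2]
        have := HasDerivAt.scomp t (hasDerivAt_powerSum_derivCoeff hb i hz)
          Complex.ofRealCLM.hasDerivAt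
        simpa [Function.comp_def] using this.hasDerivWithinAt)
      (fun t ht => hB ht.1 (ht.2.trans h1)) ζ ⟨h0, le_rfl⟩
    have hnn : 0 ≤ M' + k * (n ! * 4 ^ n * M) := (norm_nonneg _).trans (hB h0 h1)
    have hle : (M' + k * (n ! * 4 ^ n * M)) * (ζ - 1 / 2) ≤ M' + k * (n ! * 4 ^ n * M) :=
      mul_le_of_le_one_right hnn (by linarith)
    have := norm_le_norm_add_norm_sub' (powerSum (derivCoeff i b) (ζ : ℂ))
      (powerSum (derivCoeff i b) ((1 / 2 : ℝ) : ℂ))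
    push_cast at *
    linarith

/-- The abstract form of the estimate of `∂ᵐ⁺ⁿ F / ∂ζᵐ⁺ⁿ` by a `K`-functional of order `n`.
The series `a` has coefficients `ν! / (ν - m)! f_ν`, so that
`F⁽ᵐ⁾(z) = z⁻ᵐ ∑ zᵛ a_ν`; this is split along `a = (a - b) + b`, where the first summand is
estimated by Cauchy's inequality and the second by the Leibniz rule. -/
theorem exists_norm_powerSum_derivCoeff_le (m n : ℕ) : ∃ C : ℝ, 0 ≤ C ∧
    ∀ (f a b c : ℕ → E), GeomSummable f → GeomSummable a → GeomSummable b →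
    (∀ ν, a ν = ((ν.descFactorial m : ℕ) : ℂ) • f ν) →
    (∀ ν, c ν = ((ν.descFactorial n : ℕ) : ℂ) • b ν) →
    ∀ M₁ M₂ M₃ : ℝ, (∀ z ∈ stolz, ‖powerSum (a - b) z‖ ≤ M₁) →
    (∀ z ∈ stolz, ‖powerSum b z‖ ≤ M₂) → (∀ z ∈ stolz, ‖powerSum c z‖ ≤ M₃) →
    ∀ ζ : ℝ, 1 / 2 ≤ ζ → ζ < 1 →
    ‖powerSum (derivCoeff (m + n) f) ζ‖ ≤ C * (M₁ / (1 - ζ) ^ n + M₂ + M₃) := by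
  -- `A` comes from Cauchy's estimate for `a - b`, `D` from the derivatives of `z⁻ᵐ` in the Leibniz
  -- rule, and `B` bounds the derivatives of `∑ zᵛ b_ν` of order at most `n`.
  set A : ℝ := n ! * 4 ^ m * 2 ^ n with hA
  set D : ℝ := ∑ i ∈ Finset.range (n + 1), n.choose i * (i ! * 4 ^ m / (1 / 4) ^ i) with hD
  set B : ℝ := 2 ^ n + n * (n ! * 4 ^ n) with hB
  have hA0 : 0 ≤ A := by positivity
  have hD0 : 0 ≤ D := by positivity
  have hB0 : 0 ≤ B := by positivity
  refine ⟨A + D * B, by positivity, ?_⟩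
  intro f a b c hf ha hb haf hcb M₁ M₂ M₃ h₁ h₂ h₃ ζ h0 h1
  have hz0 : (0 : ℂ) ∈ stolz := ⟨0, le_rfl, one_pos, by norm_num⟩
  have hM₁ : 0 ≤ M₁ := (norm_nonneg _).trans (h₁ 0 hz0)
  have hM₂ : 0 ≤ M₂ := (norm_nonneg _).trans (h₂ 0 hz0)
  have hM₃ : 0 ≤ M₃ := (norm_nonneg _).trans (h₃ 0 hz0)
  have hreal {t : ℝ} (ht0 : 1 / 2 ≤ t) (ht1 : t < 1) : ‖(t : ℂ)‖ < 1 := by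
    rw [Complex.norm_real, Real.norm_of_nonneg (by linarith)]; exact ht1
  have hζ0 : (ζ : ℂ) ≠ 0 := by exact_mod_cast (by linarith : ζ ≠ 0)
  have hcd {e : ℕ → E} (he : GeomSummable e) : ContDiffAt ℂ n (powerSum e) (ζ : ℂ) :=
    ((differentiableOn_powerSum he).analyticAt
      (Metric.isOpen_ball.mem_nhds (by simpa using hreal h0 h1))).contDiffAt
  have hinv : ContDiffAt ℂ n (fun z : ℂ => (z ^ m)⁻¹) (ζ : ℂ) :=
    ContDiffAt.inv (contDiffAt_id.pow m) (pow_ne_zero m hζ0)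
  -- `zⁿ (d/dz)ⁿ` maps the series of `b` to that of `c`, and `t⁻ⁿ ≤ 2ⁿ`.
  have hn' : ∀ t : ℝ, 1 / 2 ≤ t → t < 1 → ‖powerSum (derivCoeff n b) t‖ ≤ 2 ^ n * M₃ := by
    intro t ht0 ht1
    have h := powerSum_eq_pow_smul hb hcb (hreal ht0 ht1)
    have h' := h₃ t (ofReal_mem_stolz (by linarith) ht1)
    rw [h, norm_smul, norm_pow, Complex.norm_real, Real.norm_of_nonneg (by linarith)] at h'
    have hp : (1 / 2 : ℝ) ^ n ≤ t ^ n := pow_le_pow_left₀ (by norm_num) ht0 n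
    have : (1 / 2 : ℝ) ^ n * ‖powerSum (derivCoeff n b) t‖ ≤ M₃ :=
      (mul_le_mul_of_nonneg_right hp (norm_nonneg _)).trans h'
    calc _ = 2 ^ n * ((1 / 2 : ℝ) ^ n * ‖powerSum (derivCoeff n b) t‖) := by
          rw [← mul_assoc, ← mul_pow]; norm_num
      _ ≤ _ := by gcongr
  have hlow (i : ℕ) (hi : i ≤ n) : ‖powerSum (derivCoeff i b) ζ‖ ≤ B * (M₂ + M₃) := by
    refine (norm_powerSum_derivCoeff_intermediate_le hb h₂ hn' (n - i) (by omega) h0 h1).trans ?_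
    have hk : ((n - i : ℕ) : ℝ) ≤ n := by exact_mod_cast Nat.sub_le n i
    have : ((n - i : ℕ) : ℝ) * (n ! * 4 ^ n * M₂) ≤ n * (n ! * 4 ^ n * M₂) := by gcongr
    have h5 : 0 ≤ (2 : ℝ) ^ n * M₂ := by positivity
    have h6 : 0 ≤ (n : ℝ) * (n ! * 4 ^ n) * M₃ := by positivity
    rw [hB]
    nlinarith
  have hsplit : (powerSum (derivCoeff m f)) =ᶠ[𝓝 (ζ : ℂ)]
      (fun z : ℂ => (z ^ m)⁻¹ • powerSum (a - b) z) +
        (fun z : ℂ => (z ^ m)⁻¹) • powerSum b := by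
    filter_upwards [Metric.isOpen_ball.mem_nhds
      (show (ζ : ℂ) ∈ Metric.ball (0 : ℂ) 1 by simpa using hreal h0 h1),
      isOpen_ne.mem_nhds hζ0] with z hz hz0
    have hz1 : ‖z‖ < 1 := by simpa using hz
    simp only [Pi.add_apply, Pi.smul_apply']
    rw [← smul_add, powerSum_sub ha hb hz1, sub_add_cancel, powerSum_eq_pow_smul hf haf hz1,
      smul_smul, inv_mul_cancel₀ (pow_ne_zero m hz0), one_smul]
  have hder : powerSum (derivCoeff (m + n) f) ζ =
      iteratedDeriv n (fun z : ℂ => (z ^ m)⁻¹ • powerSum (a - b) z) ζ +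
      iteratedDeriv n ((fun z : ℂ => (z ^ m)⁻¹) • powerSum b) ζ := by
    rw [← iteratedDeriv_powerSum_derivCoeff hf m n (hreal h0 h1), hsplit.iteratedDeriv_eq]
    exact iteratedDeriv_add (hinv.smul (hcd (ha.sub hb))) (hinv.smul (hcd hb))
  have hfirst : ‖iteratedDeriv n (fun z : ℂ => (z ^ m)⁻¹ • powerSum (a - b) z) (ζ : ℂ)‖ ≤
      A * (M₁ / (1 - ζ) ^ n) := by
    refine (norm_iteratedDeriv_inv_pow_smul_le (ha.sub hb) m n h₁ h0 h1).trans (le_of_eq ?_)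
    have : (1 - ζ) ^ n ≠ 0 := pow_ne_zero _ (by linarith)
    rw [hA, div_pow]
    field_simp
  have hsecond : ‖iteratedDeriv n ((fun z : ℂ => (z ^ m)⁻¹) • powerSum b) (ζ : ℂ)‖ ≤
      D * (B * (M₂ + M₃)) := by
    rw [← iteratedDerivWithin_univ, iteratedDerivWithin_smul (mem_univ _) uniqueDiffOn_univ
      hinv.contDiffWithinAt (hcd hb).contDiffWithinAt]
    simp only [iteratedDerivWithin_univ]
    refine (norm_sum_le _ _).trans ?_
    rw [hD, Finset.sum_mul]
    refine Finset.sum_le_sum fun i hi => ?_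
    rw [← Nat.cast_smul_eq_nsmul ℂ, norm_smul, norm_smul, Complex.norm_natCast, mul_assoc]
    rw [iteratedDeriv_powerSum hb _ (hreal h0 h1)]
    have := norm_iteratedDeriv_inv_pow_le m i h0
    have := hlow (n - i) (Nat.sub_le n i)
    gcongr
  rw [hder]
  refine (norm_add_le _ _).trans ((add_le_add hfirst hsecond).trans ?_)
  have h7 : 0 ≤ M₁ / (1 - ζ) ^ n := div_nonneg hM₁ (pow_nonneg (by linarith) _)
  have h8 : 0 ≤ A * (M₂ + M₃) := by positivity
  have h9 : 0 ≤ D * B * (M₁ / (1 - ζ) ^ n) := by positivity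
  nlinarith

end Stolz

/-! ### The torus and its characters -/

instance isProbabilityMeasure_sigma (d : ℕ) : IsProbabilityMeasure (sigma d) := by
  unfold sigma; infer_instance

instance isAddLeftInvariant_sigma (d : ℕ) : (sigma d).IsAddLeftInvariant := by
  unfold sigma; infer_instance

instance isNegInvariant_sigma (d : ℕ) : (sigma d).IsNegInvariant := by
  have : (AddCircle.haarAddCircle : Measure (AddCircle (2 * Real.pi))).Regular := by
    unfold AddCircle.haarAddCircle; infer_instance
  have : (AddCircle.haarAddCircle : Measure (AddCircle (2 * Real.pi))).IsNegInvariant :=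
    inferInstance
  unfold sigma; exact Measure.pi.isNegInvariant _

theorem continuous_char {d : ℕ} (k : Fin d → ℤ) : Continuous (char k) := by
  unfold char; fun_prop

/-- The character `e_k` as an element of the Banach space `C(𝕋ᵈ)`. -/
def charMap {d : ℕ} (k : Fin d → ℤ) : C(Torus d, ℂ) := ⟨char k, continuous_char k⟩

@[simp]
theorem charMap_apply {d : ℕ} (k : Fin d → ℤ) (x : Torus d) : charMap k x = char k x := rfl

theorem norm_char {d : ℕ} (k : Fin d → ℤ) (x : Torus d) : ‖char k x‖ = 1 := by
  simp only [char, fourier_apply, norm_prod, Circle.norm_coe, Finset.prod_const_one]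

theorem norm_charMap_le {d : ℕ} (k : Fin d → ℤ) : ‖charMap k‖ ≤ 1 :=
  (ContinuousMap.norm_le _ zero_le_one).2 fun x => (norm_char k x).le

theorem char_add {d : ℕ} (k l : Fin d → ℤ) (x : Torus d) :
    char (k + l) x = char k x * char l x := by
  simp only [char, Pi.add_apply, fourier_add, Finset.prod_mul_distrib]

theorem char_neg {d : ℕ} (k : Fin d → ℤ) (x : Torus d) :
    char (-k) x = (starRingEnd ℂ) (char k x) := by
  simp only [char, Pi.neg_apply, fourier_neg, map_prod]

theorem char_zero {d : ℕ} (x : Torus d) : char (0 : Fin d → ℤ) x = 1 := by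
  simp [char]

theorem char_single {d : ℕ} (i : Fin d) (x : Torus d) :
    char (Pi.single i 1) x = fourier 1 (x i) := by
  rw [char, Finset.prod_eq_single i]
  · simp
  · intro j _ hj; simp [Pi.single_eq_of_ne hj]
  · simp

/-- The star subalgebra of `C(𝕋ᵈ)` generated by the characters. -/
def charSubalgebra (d : ℕ) : StarSubalgebra ℂ C(Torus d, ℂ) where
  toSubalgebra := Algebra.adjoin ℂ (range charMap)
  star_mem' := by
    change Algebra.adjoin ℂ (range charMap) ≤ star (Algebra.adjoin ℂ (range charMap))
    refine Algebra.adjoin_le ?_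
    rintro _ ⟨k, rfl⟩
    refine Algebra.subset_adjoin ⟨-k, ?_⟩
    ext x
    simp [char_neg]

theorem charSubalgebra_coe (d : ℕ) :
    (charSubalgebra d).toSubalgebra.toSubmodule = Submodule.span ℂ (range charMap) := by
  apply Algebra.adjoin_eq_span_of_subset
  refine .trans (fun x => Submonoid.closure_induction (fun _ => id) ⟨0, ?_⟩ ?_)
    Submodule.subset_span
  · ext x; simp [char_zero]
  · rintro _ _ _ _ ⟨k, rfl⟩ ⟨l, rfl⟩
    exact ⟨k + l, by ext x; simp [char_add]⟩

theorem charSubalgebra_separatesPoints (d : ℕ) : (charSubalgebra d).SeparatesPoints := by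
  intro x y hxy
  obtain ⟨i, hi⟩ := Function.ne_iff.1 hxy
  refine ⟨_, ⟨charMap (Pi.single i 1), Algebra.subset_adjoin ⟨Pi.single i 1, rfl⟩, rfl⟩, ?_⟩
  simp only [charMap_apply, char_single, fourier_one]
  intro h
  exact hi (AddCircle.injective_toCircle Real.two_pi_pos.ne' (Subtype.coe_injective h))

theorem dense_span_charMap (d : ℕ) :
    (Submodule.span ℂ (range (charMap (d := d)))).topologicalClosure = ⊤ := by
  rw [← charSubalgebra_coe]
  exact congr_arg (Subalgebra.toSubmodule <| StarSubalgebra.toSubalgebra ·)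
    (ContinuousMap.starSubalgebra_topologicalClosure_eq_top_of_separatesPoints _
      (charSubalgebra_separatesPoints d))

theorem integrable_continuousMap {d : ℕ} (v : C(Torus d, ℂ)) : Integrable v (sigma d) :=
  v.continuous.integrable_of_hasCompactSupport (HasCompactSupport.of_compactSpace _)

/-- Trigonometric polynomials are dense in `L₁(𝕋ᵈ)`, by the Stone–Weierstrass theorem. -/
theorem exists_trigPolynomial_integral_norm_sub_lt {d : ℕ} {u : Torus d → ℂ}
    (hu : Integrable u (sigma d)) {ε : ℝ} (hε : 0 < ε) :
    ∃ v ∈ Submodule.span ℂ (range (charMap (d := d))), ∫ x, ‖u x - v x‖ ∂(sigma d) < ε := by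
  obtain ⟨w, hw⟩ : ∃ w : C(Torus d, ℂ), ∫ x, ‖u x - w x‖ ∂(sigma d) ≤ ε / 3 := by
    obtain ⟨w, hw, hw'⟩ := hu.exists_boundedContinuous_integral_sub_le (ε := ε / 3) (by positivity)
    exact ⟨w.toContinuousMap, hw⟩
  have hwc : w ∈ closure (Submodule.span ℂ (range (charMap (d := d))) : Set C(Torus d, ℂ)) := by
    rw [← Submodule.topologicalClosure_coe, dense_span_charMap]; trivial
  obtain ⟨v, hv, hwv⟩ := Metric.mem_closure_iff.1 hwc (ε / 3) (by positivity)
  refine ⟨v, hv, ?_⟩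
  have h1 : ∫ x, ‖u x - v x‖ ∂(sigma d) ≤ ∫ x, (‖u x - w x‖ + ε / 3) ∂(sigma d) := by
    refine integral_mono (hu.sub (integrable_continuousMap v)).norm
      ((hu.sub (integrable_continuousMap w)).norm.add (integrable_const _)) fun x => ?_
    have : ‖w x - v x‖ ≤ ε / 3 := by
      rw [← dist_eq_norm]; exact (ContinuousMap.dist_apply_le_dist x).trans hwv.le
    exact (norm_sub_le_norm_sub_add_norm_sub _ (w x) _).trans (by gcongr)
  have h2 : ∫ x, (‖u x - w x‖ + ε / 3) ∂(sigma d) = ∫ x, ‖u x - w x‖ ∂(sigma d) + ε / 3 := by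
    have := integral_add (μ := sigma d) (f := fun x => ‖u x - w x‖) (g := fun _ => ε / 3)
      (hu.sub (integrable_continuousMap w)).norm (integrable_const _)
    simpa using this
  linarith

/-! ### Fourier coefficients and homogeneous parts -/

theorem integrable_mul_conj_char {d : ℕ} {u : Torus d → ℂ} (hu : Integrable u (sigma d))
    (k : Fin d → ℤ) : Integrable (fun x => u x * (starRingEnd ℂ) (char k x)) (sigma d) := by
  refine hu.mul_bdd (c := 1) ?_ (ae_of_all _ fun x => ?_)
  · exact (Complex.continuous_conj.comp (continuous_char k)).aestronglyMeasurable
  · simp [norm_char]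

theorem coeff_sub {d : ℕ} {u v : Torus d → ℂ} (hu : Integrable u (sigma d))
    (hv : Integrable v (sigma d)) (k : Fin d → ℤ) : coeff (u - v) k = coeff u k - coeff v k := by
  simp only [coeff, Pi.sub_apply, sub_mul]
  exact integral_sub (integrable_mul_conj_char hu k) (integrable_mul_conj_char hv k)

theorem coeff_add {d : ℕ} {u v : Torus d → ℂ} (hu : Integrable u (sigma d))
    (hv : Integrable v (sigma d)) (k : Fin d → ℤ) : coeff (u + v) k = coeff u k + coeff v k := by
  simp only [coeff, Pi.add_apply, add_mul]
  exact integral_add (integrable_mul_conj_char hu k) (integrable_mul_conj_char hv k)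

theorem coeff_const_mul {d : ℕ} (c : ℂ) (u : Torus d → ℂ) (k : Fin d → ℤ) :
    coeff (fun x => c * u x) k = c * coeff u k := by
  simp only [coeff, mul_assoc]
  exact integral_const_mul c _

theorem norm_coeff_le {d : ℕ} (u : Torus d → ℂ) (k : Fin d → ℤ) :
    ‖coeff u k‖ ≤ ∫ x, ‖u x‖ ∂(sigma d) := by
  refine (norm_integral_le_integral_norm _).trans (le_of_eq ?_)
  simp [norm_char]

theorem coeff_congr_ae {d : ℕ} {u v : Torus d → ℂ} (h : u =ᵐ[sigma d] v) (k : Fin d → ℤ) :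
    coeff u k = coeff v k :=
  integral_congr_ae (h.mono fun x hx => by simp [hx])

theorem integral_fourier (l : ℤ) :
    ∫ t : AddCircle (2 * Real.pi), fourier l t ∂AddCircle.haarAddCircle =
      if l = 0 then 1 else 0 := by
  split_ifs with h
  · subst h; simp
  · exact integral_eq_zero_of_add_right_eq_neg (fourier_add_half_inv_index h Real.two_pi_pos)

theorem integral_char {d : ℕ} (k : Fin d → ℤ) :
    ∫ x, char k x ∂(sigma d) = if k = 0 then 1 else 0 := by
  simp only [char, sigma]
  rw [integral_fintype_prod_eq_prod (fun j t => (fourier (k j) t : ℂ))]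
  simp only [integral_fourier]
  split_ifs with h
  · simp [h]
  · obtain ⟨j, hj⟩ := Function.ne_iff.1 h
    exact Finset.prod_eq_zero (Finset.mem_univ j) (by simpa using hj)

theorem coeff_char {d : ℕ} (k l : Fin d → ℤ) : coeff (char k) l = if k = l then 1 else 0 := by
  simp only [coeff, ← char_neg, ← char_add, integral_char, ← sub_eq_add_neg, sub_eq_zero]

/-- The homogeneous part `∑_{|k|₁ = ν} û_k e_k` of the Fourier series of `u`. -/
def homPart {d : ℕ} (u : Torus d → ℂ) (ν : ℕ) : C(Torus d, ℂ) :=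
  ∑ k ∈ sphere d ν, coeff u k • charMap k

theorem homPart_sub {d : ℕ} {u v : Torus d → ℂ} (hu : Integrable u (sigma d))
    (hv : Integrable v (sigma d)) : homPart (u - v) = homPart u - homPart v := by
  ext1 ν
  simp [homPart, coeff_sub hu hv, sub_smul, Finset.sum_sub_distrib]

theorem homPart_congr_ae {d : ℕ} {u v : Torus d → ℂ} (h : u =ᵐ[sigma d] v) :
    homPart u = homPart v := by
  ext1 ν
  simp [homPart, coeff_congr_ae h]

theorem card_sphere_le (d ν : ℕ) : (sphere d ν).card ≤ (2 * ν + 1) ^ d := by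
  refine (Finset.card_filter_le _ _).trans ?_
  rw [Fintype.card_piFinset_const, Int.card_Icc]
  apply le_of_eq
  congr 1
  omega

theorem norm_homPart_le {d : ℕ} (u : Torus d → ℂ) (ν : ℕ) :
    ‖homPart u ν‖ ≤ (2 * ν + 1) ^ d * ∫ x, ‖u x‖ ∂(sigma d) := by
  refine (norm_sum_le _ _).trans ?_
  have h : ∀ k ∈ sphere d ν, ‖coeff u k • charMap k‖ ≤ ∫ x, ‖u x‖ ∂(sigma d) := fun k _ => by
    rw [norm_smul]
    exact (mul_le_of_le_one_right (norm_nonneg _) (norm_charMap_le k)).trans (norm_coeff_le u k)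
  refine (Finset.sum_le_card_nsmul _ _ _ h).trans ?_
  rw [nsmul_eq_mul]
  refine mul_le_mul_of_nonneg_right ?_ (integral_nonneg fun x => norm_nonneg _)
  exact_mod_cast card_sphere_le d ν

theorem summable_pow_mul_polynomial (d : ℕ) {t : ℝ} (h0 : 0 ≤ t) (h1 : t < 1) :
    Summable fun ν : ℕ => t ^ ν * (2 * (ν : ℝ) + 1) ^ d := by
  have hs : Summable fun ν : ℕ => ((ν : ℝ) ^ d * t ^ ν + (0 : ℝ) ^ ν) * 3 ^ d :=
    ((summable_pow_mul_geometric_of_norm_lt_one d (by rwa [Real.norm_of_nonneg h0])).add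
      (summable_geometric_of_lt_one le_rfl one_pos)).mul_right _
  refine Summable.of_nonneg_of_le (fun ν => by positivity) (fun ν => ?_) hs
  rcases Nat.eq_zero_or_pos ν with rfl | hν
  · have h3 : (1 : ℝ) ≤ 3 ^ d := one_le_pow₀ (by norm_num)
    have : (0 : ℝ) ≤ 0 ^ d := by positivity
    simp
    nlinarith
  · have : (2 * (ν : ℝ) + 1) ^ d ≤ (ν * 3) ^ d := by
      have : (1 : ℝ) ≤ ν := by exact_mod_cast hν
      gcongr
      linarith
    rw [mul_pow] at this
    rw [zero_pow hν.ne', add_zero, mul_comm ((ν : ℝ) ^ d), mul_assoc]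
    gcongr

theorem geomSummable_homPart {d : ℕ} (u : Torus d → ℂ) : GeomSummable (homPart u) := by
  intro t h0 h1
  refine Summable.of_nonneg_of_le (fun ν => by positivity) (fun ν => ?_)
    ((summable_pow_mul_polynomial d h0 h1).mul_right (∫ x, ‖u x‖ ∂(sigma d)))
  rw [mul_assoc]
  gcongr
  exact norm_homPart_le u ν

theorem norm_powerSum_homPart_le {d : ℕ} (u : Torus d → ℂ) {z : ℂ} (hz : ‖z‖ < 1) :
    ‖powerSum (homPart u) z‖ ≤
      (∑' ν : ℕ, ‖z‖ ^ ν * (2 * (ν : ℝ) + 1) ^ d) * ∫ x, ‖u x‖ ∂(sigma d) := by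
  rw [← tsum_mul_right]
  refine tsum_of_norm_bounded
    ((summable_pow_mul_polynomial d (norm_nonneg z) hz).mul_right _).hasSum fun ν => ?_
  rw [norm_smul, norm_pow, mul_assoc]
  gcongr
  exact norm_homPart_le u ν

theorem homPart_char {d : ℕ} (k : Fin d → ℤ) (ν : ℕ) :
    homPart (char k) ν = if ν = l1 k then charMap k else 0 := by
  simp only [homPart, coeff_char, ite_smul, one_smul, zero_smul]
  rw [Finset.sum_ite_eq]
  simp [mem_sphere, eq_comm]

theorem powerSum_homPart_char {d : ℕ} (k : Fin d → ℤ) (z : ℂ) :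
    powerSum (homPart (char k)) z = z ^ l1 k • charMap k := by
  rw [powerSum, tsum_eq_single (l1 k)]
  · simp [homPart_char]
  · intro ν hν; simp [homPart_char, hν]

theorem homPart_add {d : ℕ} {u v : Torus d → ℂ} (hu : Integrable u (sigma d))
    (hv : Integrable v (sigma d)) : homPart (u + v) = homPart u + homPart v := by
  ext1 ν
  simp [homPart, coeff_add hu hv, add_smul, Finset.sum_add_distrib]

theorem powerSum_homPart_add {d : ℕ} {u v : Torus d → ℂ} (hu : Integrable u (sigma d))
    (hv : Integrable v (sigma d)) {z : ℂ} (hz : ‖z‖ < 1) :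
    powerSum (homPart (u + v)) z = powerSum (homPart u) z + powerSum (homPart v) z := by
  rw [homPart_add hu hv, powerSum, powerSum, powerSum,
    ← ((geomSummable_homPart u).summable hz).tsum_add ((geomSummable_homPart v).summable hz)]
  simp

theorem powerSum_homPart_const_mul {d : ℕ} (c : ℂ) (u : Torus d → ℂ) (z : ℂ) :
    powerSum (homPart (fun x => c * u x)) z = c • powerSum (homPart u) z := by
  rw [powerSum, powerSum, ← tsum_const_smul'' c]
  refine tsum_congr fun ν => ?_
  simp only [homPart, coeff_const_mul, ← smul_smul, ← Finset.smul_sum]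
  rw [smul_comm]

/-! ### The Poisson kernel with complex parameter -/

/-- The Poisson kernel `∑ z^|l| e^{ilt}` on the circle, in closed form, for complex `z`. -/
def circlePoisson (z : ℂ) (t : AddCircle (2 * Real.pi)) : ℂ :=
  (1 - z ^ 2) / ((1 - z * fourier 1 t) * (1 - z * fourier (-1) t))

theorem norm_fourier_apply (l : ℤ) (t : AddCircle (2 * Real.pi)) : ‖fourier l t‖ = 1 := by
  rw [fourier_apply, Circle.norm_coe]

theorem fourier_natCast (n : ℕ) (t : AddCircle (2 * Real.pi)) :
    (fourier (n : ℤ) t : ℂ) = (fourier 1 t : ℂ) ^ n := by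
  induction n with
  | zero => simp
  | succ n ih => rw [Nat.cast_succ, fourier_add, ih, pow_succ]

theorem fourier_neg_natCast (n : ℕ) (t : AddCircle (2 * Real.pi)) :
    (fourier (-(n : ℤ)) t : ℂ) = (fourier (-1) t : ℂ) ^ n := by
  rw [fourier_neg, fourier_natCast, fourier_neg, map_pow]

theorem one_sub_mul_fourier_ne_zero {z : ℂ} (hz : ‖z‖ < 1) (l : ℤ)
    (t : AddCircle (2 * Real.pi)) : 1 - z * fourier l t ≠ 0 := by
  intro h
  have : ‖z * fourier l t‖ = 1 := by rw [← sub_eq_zero.1 h, norm_one]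
  rw [norm_mul, norm_fourier_apply, mul_one] at this
  linarith

theorem continuous_circlePoisson {z : ℂ} (hz : ‖z‖ < 1) : Continuous (circlePoisson z) := by
  unfold circlePoisson
  refine Continuous.div (by fun_prop) (by fun_prop) fun t => ?_
  exact mul_ne_zero (one_sub_mul_fourier_ne_zero hz 1 t) (one_sub_mul_fourier_ne_zero hz (-1) t)

theorem geometric_add_geometric_eq {z a b : ℂ} (hab : a * b = 1) (ha : 1 - z * a ≠ 0)
    (hb : 1 - z * b ≠ 0) :
    (1 - z * a)⁻¹ + (1 - z * b)⁻¹ * (z * b) = (1 - z ^ 2) / ((1 - z * a) * (1 - z * b)) := by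
  field_simp
  linear_combination (-z ^ 2) * hab

/-- Both halves of the series are geometric. -/
theorem hasSum_circlePoisson {z : ℂ} (hz : ‖z‖ < 1) (t : AddCircle (2 * Real.pi)) :
    HasSum (fun l : ℤ => z ^ l.natAbs * fourier l t) (circlePoisson z t) := by
  have hw (l : ℤ) : ‖z * fourier l t‖ < 1 := by rw [norm_mul, norm_fourier_apply, mul_one]; exact hz
  have h1 : HasSum (fun n : ℕ => z ^ (n : ℤ).natAbs * fourier (n : ℤ) t)
      (1 - z * fourier 1 t)⁻¹ := by
    have h := hasSum_geometric_of_norm_lt_one (hw 1)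
    simp_rw [mul_pow, ← fourier_natCast] at h
    simpa only [Int.natAbs_natCast] using h
  have h2 : HasSum (fun n : ℕ => z ^ (-((n : ℤ) + 1)).natAbs * fourier (-((n : ℤ) + 1)) t)
      ((1 - z * fourier (-1) t)⁻¹ * (z * fourier (-1) t)) := by
    have h := (hasSum_geometric_of_norm_lt_one (hw (-1))).mul_right (z * fourier (-1) t)
    simp_rw [← pow_succ, mul_pow, ← fourier_neg_natCast, Nat.cast_succ] at h
    have h3 (n : ℕ) : (-((n : ℤ) + 1)).natAbs = n + 1 := by omega
    simpa only [h3] using h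
  have hmul : (fourier 1 t : ℂ) * fourier (-1) t = 1 := by
    rw [← fourier_add, add_neg_cancel, fourier_zero]
  rw [circlePoisson, ← geometric_add_geometric_eq hmul (one_sub_mul_fourier_ne_zero hz 1 t)
    (one_sub_mul_fourier_ne_zero hz (-1) t)]
  exact HasSum.of_nat_of_neg_add_one h1 h2

theorem integral_circlePoisson_mul_fourier {z : ℂ} (hz : ‖z‖ < 1) (l : ℤ)
    (s : AddCircle (2 * Real.pi)) :
    ∫ t, circlePoisson z (s - t) * fourier l t ∂AddCircle.haarAddCircle =
      z ^ l.natAbs * fourier l s := by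
  have hsum : Summable fun j : ℤ => ‖z‖ ^ j.natAbs := by
    have h := summable_geometric_of_lt_one (norm_nonneg z) hz
    refine Summable.of_nat_of_neg_add_one (by simpa using h) ?_
    refine ((summable_nat_add_iff 1).2 h).congr fun n => ?_
    rw [show (-((n : ℤ) + 1)).natAbs = n + 1 by omega]
  set F : ℤ → AddCircle (2 * Real.pi) → ℂ := fun j t =>
    z ^ j.natAbs * fourier j (s - t) * fourier l t with hF
  have hFn (j : ℤ) (t) : ‖F j t‖ = ‖z‖ ^ j.natAbs := by
    simp only [hF, norm_mul, norm_pow, norm_fourier_apply, mul_one]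
  have hFe (j : ℤ) (t) : F j t = z ^ j.natAbs * fourier j s * fourier (l - j) t := by
    have h1 : (fourier j (s - t) : ℂ) = fourier j s * fourier (-j) t := by
      rw [fourier_apply, fourier_apply, fourier_apply, smul_sub, sub_eq_add_neg, ← neg_smul,
        AddCircle.toCircle_add, Circle.coe_mul]
    rw [hF]
    simp only
    rw [h1, sub_eq_neg_add, fourier_add]
    ring
  have hFc (j : ℤ) : Continuous (F j) := by
    simp only [hF]
    fun_prop
  have h := hasSum_integral_of_summable_integral_norm (μ := AddCircle.haarAddCircle) (F := F)
    (fun j => (hFc j).integrable_of_hasCompactSupport (HasCompactSupport.of_compactSpace _))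
    (by simpa [hFn] using hsum)
  have h' : HasSum (fun j : ℤ => ∫ t, F j t ∂AddCircle.haarAddCircle)
      (z ^ l.natAbs * fourier l s) := by
    convert hasSum_ite_eq l (z ^ l.natAbs * (fourier l s : ℂ)) using 2 with j
    simp only [hFe]
    rw [integral_const_mul, integral_fourier]
    by_cases hj : j = l
    · simp [hj]
    · rw [if_neg (by omega), if_neg hj, mul_zero]
  rw [h'.unique h]
  refine integral_congr_ae (ae_of_all _ fun t => ?_)
  exact (((hasSum_circlePoisson hz (s - t)).mul_right (fourier l t)).tsum_eq).symm

theorem circlePoisson_ofReal {ζ : ℝ} (t : AddCircle (2 * Real.pi)) :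
    circlePoisson ζ t = ((1 - ζ ^ 2) / ‖1 - ζ * (fourier 1 t : ℂ)‖ ^ 2 : ℝ) := by
  rw [circlePoisson]
  have : 1 - (ζ : ℂ) * fourier (-1) t = (starRingEnd ℂ) (1 - (ζ : ℂ) * fourier 1 t) := by
    rw [fourier_neg]; simp
  rw [this, Complex.mul_conj, Complex.normSq_eq_norm_sq]
  push_cast
  rfl

theorem circlePoisson_ofReal_eq_norm {ζ : ℝ} (h0 : 0 ≤ ζ) (h1 : ζ < 1)
    (t : AddCircle (2 * Real.pi)) : circlePoisson ζ t = (‖circlePoisson ζ t‖ : ℂ) := by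
  have : 0 ≤ (1 - ζ ^ 2) / ‖1 - ζ * (fourier 1 t : ℂ)‖ ^ 2 :=
    div_nonneg (by nlinarith) (by positivity)
  rw [circlePoisson_ofReal, Complex.norm_real, Real.norm_of_nonneg this]

/-- In the disc of radius `(1 - ζ) / 2` about `ζ` the complex Poisson kernel is dominated pointwise
by the real Poisson kernel with parameter `ζ`. -/
theorem norm_circlePoisson_le {ζ : ℝ} (h0 : 0 ≤ ζ) (h1 : ζ < 1) {z : ℂ}
    (hz : ‖z - ζ‖ ≤ (1 - ζ) / 2) (t : AddCircle (2 * Real.pi)) :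
    ‖circlePoisson z t‖ ≤ 12 * ‖circlePoisson ζ t‖ := by
  have hz1 : ‖z‖ < 1 := norm_lt_one_of_mem_stolz ⟨ζ, h0, h1, hz⟩
  have hζ1 : ‖(ζ : ℂ)‖ < 1 := by rwa [Complex.norm_real, Real.norm_of_nonneg h0]
  -- Since `1 - ζ ≤ |1 - ζ w|` for `|w| = 1`, moving `ζ` by `(1 - ζ) / 2` at most halves
  -- `|1 - ζ w|`.
  have hden (l : ℤ) : ‖1 - ζ * (fourier l t : ℂ)‖ ≤ 2 * ‖1 - z * (fourier l t : ℂ)‖ := by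
    have e1 : 1 - ζ ≤ ‖1 - ζ * (fourier l t : ℂ)‖ := by
      have := norm_sub_norm_le (1 : ℂ) (ζ * (fourier l t : ℂ))
      rw [norm_one, norm_mul, norm_fourier_apply, Complex.norm_real, Real.norm_of_nonneg h0,
        mul_one] at this
      exact this
    have e2 : ‖1 - ζ * (fourier l t : ℂ)‖ ≤ ‖1 - z * (fourier l t : ℂ)‖ + ‖z - ζ‖ := by
      have := norm_add_le (1 - z * (fourier l t : ℂ)) ((z - ζ) * (fourier l t : ℂ))
      rw [norm_mul, norm_fourier_apply, mul_one] at this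
      refine le_trans (le_of_eq ?_) this
      congr 1
      ring
    linarith
  have hpos (w : ℂ) (hw : ‖w‖ < 1) (l : ℤ) : 0 < ‖1 - w * (fourier l t : ℂ)‖ :=
    norm_pos_iff.2 (one_sub_mul_fourier_ne_zero hw l t)
  have hnum : ‖1 - z ^ 2‖ ≤ 3 * ‖1 - (ζ : ℂ) ^ 2‖ := by
    have e1 : ‖1 - (ζ : ℂ) ^ 2‖ = 1 - ζ ^ 2 := by
      rw [show (1 - (ζ : ℂ) ^ 2) = ((1 - ζ ^ 2 : ℝ) : ℂ) by push_cast; rfl, Complex.norm_real,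
        Real.norm_of_nonneg (by nlinarith)]
    have e2 : ‖1 - z‖ ≤ (1 - ζ) + (1 - ζ) / 2 := by
      have := norm_sub_le_norm_sub_add_norm_sub (1 : ℂ) ζ z
      rw [norm_sub_rev (ζ : ℂ) z, show (1 - (ζ : ℂ)) = ((1 - ζ : ℝ) : ℂ) by push_cast; rfl,
        Complex.norm_real, Real.norm_of_nonneg (by linarith)] at this
      linarith
    have e3 : ‖1 + z‖ ≤ 2 := by
      have := norm_add_le (1 : ℂ) z
      rw [norm_one] at this
      linarith
    rw [e1, show 1 - z ^ 2 = (1 - z) * (1 + z) by ring, norm_mul]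
    have := mul_le_mul e2 e3 (norm_nonneg _) (by linarith)
    nlinarith
  rw [circlePoisson, circlePoisson, norm_div, norm_div, norm_mul, norm_mul, ← mul_div_assoc,
    div_le_div_iff₀ (mul_pos (hpos z hz1 _) (hpos z hz1 _))
      (mul_pos (hpos _ hζ1 _) (hpos _ hζ1 _))]
  calc _ ≤ (3 * ‖1 - (ζ : ℂ) ^ 2‖) * ((2 * ‖1 - z * (fourier 1 t : ℂ)‖) *
        (2 * ‖1 - z * (fourier (-1) t : ℂ)‖)) := by
        have := hden 1
        have := hden (-1)
        gcongr
    _ = _ := by ring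

/-- The Poisson kernel `∑ z^{|k|₁} e_k` on `𝕋ᵈ`, a product of kernels in one variable. -/
def poisson {d : ℕ} (z : ℂ) (x : Torus d) : ℂ := ∏ j, circlePoisson z (x j)

theorem continuous_poisson {d : ℕ} {z : ℂ} (hz : ‖z‖ < 1) :
    Continuous (poisson (d := d) z) :=
  continuous_finsetProd _ fun j _ => (continuous_circlePoisson hz).comp (continuous_apply j)

theorem integral_poisson_mul_char {d : ℕ} {z : ℂ} (hz : ‖z‖ < 1) (k : Fin d → ℤ) (x : Torus d) :
    ∫ y, char k y * poisson z (x - y) ∂(sigma d) = z ^ l1 k * char k x := by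
  simp only [char, poisson, sigma, ← Finset.prod_mul_distrib, Pi.sub_apply]
  rw [integral_fintype_prod_eq_prod
    (fun j t => (fourier (k j) t : ℂ) * circlePoisson z (x j - t))]
  simp_rw [mul_comm (fourier _ _ : ℂ), integral_circlePoisson_mul_fourier hz]
  rw [Finset.prod_mul_distrib, Finset.prod_pow_eq_pow_sum, l1]

theorem norm_poisson_le {d : ℕ} {ζ : ℝ} (h0 : 0 ≤ ζ) (h1 : ζ < 1) {z : ℂ}
    (hz : ‖z - ζ‖ ≤ (1 - ζ) / 2) (x : Torus d) :
    ‖poisson z x‖ ≤ 12 ^ d * ‖poisson ζ x‖ := by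
  rw [poisson, poisson, norm_prod, norm_prod]
  calc _ ≤ ∏ j, 12 * ‖circlePoisson ζ (x j)‖ :=
        Finset.prod_le_prod (fun _ _ => norm_nonneg _)
          fun j _ => norm_circlePoisson_le h0 h1 hz (x j)
    _ = _ := by rw [Finset.prod_mul_distrib]; simp

theorem integral_norm_poisson {d : ℕ} {ζ : ℝ} (h0 : 0 ≤ ζ) (h1 : ζ < 1) :
    ∫ y : Torus d, ‖poisson ζ y‖ ∂(sigma d) = 1 := by
  have hζ1 : ‖(ζ : ℂ)‖ < 1 := by rwa [Complex.norm_real, Real.norm_of_nonneg h0]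
  have h := integral_poisson_mul_char (d := d) hζ1 0 0
  simp only [char_zero, one_mul, l1, Pi.zero_apply, Int.natAbs_zero, Finset.sum_const_zero,
    pow_zero] at h
  rw [integral_sub_left_eq_self (fun y => poisson (ζ : ℂ) y) (sigma d) 0] at h
  have hn (y : Torus d) : poisson (ζ : ℂ) y = (‖poisson (ζ : ℂ) y‖ : ℂ) := by
    rw [poisson, norm_prod, Complex.ofReal_prod]
    exact Finset.prod_congr rfl fun j _ => circlePoisson_ofReal_eq_norm h0 h1 (y j)
  rw [integral_congr_ae (ae_of_all _ hn), integral_complex_ofReal] at h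
  exact_mod_cast h

theorem integrable_mul_poisson {d : ℕ} {u : Torus d → ℂ} (hu : Integrable u (sigma d)) {z : ℂ}
    (hz : ‖z‖ < 1) (x : Torus d) : Integrable (fun y => u y * poisson z (x - y)) (sigma d) := by
  have hc : Continuous fun y : Torus d => poisson z (x - y) :=
    (continuous_poisson hz).comp (continuous_const.sub continuous_id)
  obtain ⟨C, hC⟩ := (isCompact_range hc).isBounded.exists_norm_le
  exact hu.mul_bdd (c := C) hc.aestronglyMeasurable (ae_of_all _ fun y => hC _ ⟨y, rfl⟩)

/-- The Poisson integral of an integrable function is the sum of its Abel-weighted Fourier series.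
Both sides are continuous in `u ∈ L₁` and agree for trigonometric polynomials. -/
theorem powerSum_homPart_eq_integral {d : ℕ} {u : Torus d → ℂ} (hu : Integrable u (sigma d))
    {z : ℂ} (hz : ‖z‖ < 1) (x : Torus d) :
    powerSum (homPart u) z x = ∫ y, u y * poisson z (x - y) ∂(sigma d) := by
  have htrig : ∀ v ∈ Submodule.span ℂ (range (charMap (d := d))),
      powerSum (homPart v) z x = ∫ y, v y * poisson z (x - y) ∂(sigma d) := by
    intro v hv
    induction hv using Submodule.span_induction with
    | mem v hv =>
      obtain ⟨k, rfl⟩ := hv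
      rw [show ⇑(charMap k) = char k from rfl, powerSum_homPart_char,
        integral_poisson_mul_char hz]
      simp
    | zero =>
      simp [powerSum, homPart, coeff]
    | add v w _ _ hv hw =>
      rw [ContinuousMap.coe_add, powerSum_homPart_add (integrable_continuousMap v)
        (integrable_continuousMap w) hz, ContinuousMap.add_apply, hv, hw,
        ← integral_add (integrable_mul_poisson (integrable_continuousMap v) hz x)
          (integrable_mul_poisson (integrable_continuousMap w) hz x)]
      simp [add_mul]
    | smul c v _ hv =>
      rw [show ⇑(c • v) = fun x => c * v x from rfl, powerSum_homPart_const_mul,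
        ContinuousMap.smul_apply, hv, smul_eq_mul, ← integral_const_mul]
      simp [mul_assoc]
  have hc : Continuous fun y : Torus d => poisson z (x - y) :=
    (continuous_poisson hz).comp (continuous_const.sub continuous_id)
  obtain ⟨C, hC⟩ := (isCompact_range hc).isBounded.exists_norm_le
  set K := ∑' ν : ℕ, ‖z‖ ^ ν * (2 * (ν : ℝ) + 1) ^ d with hK
  have hK0 : 0 ≤ K := tsum_nonneg fun ν => by positivity
  have hC0 : 0 ≤ C := (norm_nonneg _).trans (hC _ ⟨0, rfl⟩)
  rw [← sub_eq_zero, ← norm_le_zero_iff]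
  refine le_of_forall_pos_le_add fun ε hε => ?_
  obtain ⟨v, hv, huv⟩ := exists_trigPolynomial_integral_norm_sub_lt hu
    (ε := ε / (K + C + 1)) (by positivity)
  have hvi := integrable_continuousMap v
  have e1 : powerSum (homPart u) z x - ∫ y, u y * poisson z (x - y) ∂(sigma d) =
      powerSum (homPart (u - ⇑v)) z x - ∫ y, (u y - v y) * poisson z (x - y) ∂(sigma d) := by
    rw [homPart_sub hu hvi, powerSum_sub (geomSummable_homPart u) (geomSummable_homPart _) hz,
      ContinuousMap.sub_apply, htrig v hv]
    simp_rw [sub_mul]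
    rw [integral_sub (integrable_mul_poisson hu hz x) (integrable_mul_poisson hvi hz x)]
    ring
  have e2 : ‖powerSum (homPart (u - ⇑v)) z x‖ ≤ K * ∫ y, ‖u y - v y‖ ∂(sigma d) :=
    (ContinuousMap.norm_coe_le_norm _ x).trans (norm_powerSum_homPart_le (u - ⇑v) hz)
  have e3 : ‖∫ y, (u y - v y) * poisson z (x - y) ∂(sigma d)‖ ≤
      C * ∫ y, ‖u y - v y‖ ∂(sigma d) := by
    refine (norm_integral_le_integral_norm _).trans ?_
    rw [← integral_const_mul]
    refine integral_mono_of_nonneg (ae_of_all _ fun y => norm_nonneg _)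
      ((hu.sub hvi).norm.const_mul C) (ae_of_all _ fun y => ?_)
    simp only [norm_mul]
    rw [mul_comm]
    exact mul_le_mul_of_nonneg_right (hC _ ⟨y, rfl⟩) (norm_nonneg _)
  rw [e1]
  refine (norm_sub_le _ _).trans ((add_le_add e2 e3).trans ?_)
  rw [← add_mul, zero_add]
  calc _ ≤ (K + C) * (ε / (K + C + 1)) := by gcongr
    _ ≤ ε := by
      rw [← mul_div_assoc, div_le_iff₀ (by positivity)]
      nlinarith

/-! ### Boundedness of Poisson integrals in `L_p` -/

/-- Averaging over translates with respect to a probability measure does not increase the `L_p`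
norm: Jensen's inequality for the inner integral and Tonelli's theorem. -/
theorem eLpNorm_le_of_enorm_le_average {d : ℕ} {p : ℝ≥0∞} (hp : 1 ≤ p) {u : Torus d → ℂ}
    (hu : Measurable u) (μ : Measure (Torus d)) [IsProbabilityMeasure μ] (hμ : μ ≪ sigma d)
    {F : Torus d → ℂ} {c : ℝ≥0∞}
    (hF : ∀ x, ‖F x‖ₑ ≤ c * ∫⁻ y, ‖u (x - y)‖ₑ ∂μ) :
    eLpNorm F p (sigma d) ≤ c * eLpNorm u p (sigma d) := by
  have hmeas (x : Torus d) : Measurable fun y => u (x - y) := by fun_prop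
  have hJ (x : Torus d) : ‖F x‖ₑ ≤ c * eLpNorm (fun y => u (x - y)) p μ := by
    refine (hF x).trans ?_
    refine mul_le_mul' le_rfl ?_
    rw [← eLpNorm_one_eq_lintegral_enorm]
    exact eLpNorm_le_eLpNorm_of_exponent_le hp (hmeas x).aestronglyMeasurable
  by_cases hpt : p = ∞
  · subst hpt
    rw [eLpNorm_exponent_top]
    refine essSup_le_of_ae_le _ (ae_of_all _ fun x => (hJ x).trans ?_)
    refine mul_le_mul' le_rfl ?_
    rw [← eLpNorm_comp_measurePreserving hu.aestronglyMeasurable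
      (Measure.measurePreserving_sub_left (sigma d) x), eLpNorm_exponent_top, eLpNorm_exponent_top]
    exact eLpNormEssSup_mono_measure _ hμ
  have hp0 : p ≠ 0 := (one_pos.trans_le hp).ne'
  have hpr : 0 < p.toReal := ENNReal.toReal_pos hp0 hpt
  have hpow (x : Torus d) : eLpNorm (fun y => u (x - y)) p μ ^ p.toReal =
      ∫⁻ y, ‖u (x - y)‖ₑ ^ p.toReal ∂μ := by
    rw [eLpNorm_eq_lintegral_rpow_enorm_toReal hp0 hpt, ← ENNReal.rpow_mul,
      one_div_mul_cancel hpr.ne', ENNReal.rpow_one]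
  have hswap : ∫⁻ x, ∫⁻ y, ‖u (x - y)‖ₑ ^ p.toReal ∂μ ∂(sigma d) =
      ∫⁻ x, ‖u x‖ₑ ^ p.toReal ∂(sigma d) := by
    rw [lintegral_lintegral_swap (by fun_prop)]
    simp_rw [lintegral_sub_right_eq_self (fun x => ‖u x‖ₑ ^ p.toReal)]
    simp
  rw [eLpNorm_eq_lintegral_rpow_enorm_toReal hp0 hpt,
    eLpNorm_eq_lintegral_rpow_enorm_toReal hp0 hpt]
  calc (∫⁻ x, ‖F x‖ₑ ^ p.toReal ∂(sigma d)) ^ (1 / p.toReal)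
      ≤ (∫⁻ x, c ^ p.toReal * ∫⁻ y, ‖u (x - y)‖ₑ ^ p.toReal ∂μ ∂(sigma d)) ^ (1 / p.toReal) := by
        refine ENNReal.rpow_le_rpow (lintegral_mono fun x => ?_) (by positivity)
        rw [← hpow, ← ENNReal.mul_rpow_of_nonneg _ _ hpr.le]
        exact ENNReal.rpow_le_rpow (hJ x) hpr.le
    _ = c * (∫⁻ x, ‖u x‖ₑ ^ p.toReal ∂(sigma d)) ^ (1 / p.toReal) := by
        rw [lintegral_const_mul _ (by fun_prop), hswap,
          ENNReal.mul_rpow_of_nonneg _ _ (by positivity), ← ENNReal.rpow_mul,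
          mul_one_div_cancel hpr.ne', ENNReal.rpow_one]

theorem lintegral_enorm_poisson {d : ℕ} {ζ : ℝ} (h0 : 0 ≤ ζ) (h1 : ζ < 1) :
    ∫⁻ y : Torus d, ‖poisson ζ y‖ₑ ∂(sigma d) = 1 := by
  have hζ1 : ‖(ζ : ℂ)‖ < 1 := by rwa [Complex.norm_real, Real.norm_of_nonneg h0]
  have hi : Integrable (poisson (d := d) ζ) (sigma d) :=
    integrable_continuousMap ⟨_, continuous_poisson hζ1⟩
  rw [← ofReal_integral_norm_eq_lintegral_enorm hi, integral_norm_poisson h0 h1, ENNReal.ofReal_one]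

/-- Poisson integrals are bounded in `L_p`, uniformly for parameters in `stolz`. -/
theorem eLpNorm_powerSum_homPart_le {d : ℕ} {p : ℝ≥0∞} (hp : 1 ≤ p) {u : Torus d → ℂ}
    (hu : MemLp u p (sigma d)) {z : ℂ} (hz : z ∈ stolz) :
    eLpNorm (⇑(powerSum (homPart u) z)) p (sigma d) ≤ 12 ^ d * eLpNorm u p (sigma d) := by
  have hz1 := norm_lt_one_of_mem_stolz hz
  obtain ⟨ζ, h0, h1, hzζ⟩ := hz
  have hζ1 : ‖(ζ : ℂ)‖ < 1 := by rwa [Complex.norm_real, Real.norm_of_nonneg h0]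
  -- Fourier coefficients do not see null sets, so `u` may be replaced by a measurable version.
  set v := hu.1.mk u
  have huv : u =ᵐ[sigma d] v := hu.1.ae_eq_mk
  have hvm : Measurable v := hu.1.stronglyMeasurable_mk.measurable
  rw [homPart_congr_ae huv, eLpNorm_congr_ae huv]
  have hvi : Integrable v (sigma d) := ((memLp_congr_ae huv).1 hu).integrable hp
  have hPm : Measurable fun y : Torus d => ‖poisson (ζ : ℂ) y‖ₑ :=
    (continuous_poisson hζ1).measurable.enorm
  have hprob : IsProbabilityMeasure
      ((sigma d).withDensity fun y => ‖poisson (ζ : ℂ) y‖ₑ) :=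
    ⟨by rw [withDensity_apply _ .univ, Measure.restrict_univ, lintegral_enorm_poisson h0 h1]⟩
  refine eLpNorm_le_of_enorm_le_average hp hvm
    ((sigma d).withDensity fun y => ‖poisson (ζ : ℂ) y‖ₑ)
    (withDensity_absolutelyContinuous _ _) fun x => ?_
  rw [powerSum_homPart_eq_integral hvi hz1]
  refine (enorm_integral_le_lintegral_enorm _).trans ?_
  rw [lintegral_withDensity_eq_lintegral_mul _ hPm (by fun_prop),
    ← lintegral_const_mul _ (by fun_prop), ← lintegral_sub_left_eq_self _ x]
  refine lintegral_mono fun y => ?_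
  simp only [Pi.mul_apply, sub_sub_cancel, enorm_mul]
  rw [← mul_assoc, mul_comm]
  gcongr
  have h := norm_poisson_le h0 h1 hzζ y
  rw [← ofReal_norm, ← ofReal_norm]
  refine (ENNReal.ofReal_le_ofReal h).trans (le_of_eq ?_)
  rw [ENNReal.ofReal_mul (by positivity), ENNReal.ofReal_pow (by norm_num)]
  norm_num

/-! ### Convergence of Poisson integrals to the function -/

theorem tendsto_powerSum_homPart_of_mem_span {d : ℕ} {v : C(Torus d, ℂ)}
    (hv : v ∈ Submodule.span ℂ (range (charMap (d := d)))) :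
    Tendsto (fun R : ℝ => powerSum (homPart v) (R : ℂ)) (𝓝[<] 1) (𝓝 v) := by
  have hlt : ∀ᶠ R : ℝ in 𝓝[<] 1, ‖(R : ℂ)‖ < 1 := by
    filter_upwards [Ioo_mem_nhdsLT (show (0 : ℝ) < 1 by norm_num)] with R hR
    rw [Complex.norm_real, Real.norm_of_nonneg hR.1.le]; exact hR.2
  induction hv using Submodule.span_induction with
  | mem v hv =>
    obtain ⟨k, rfl⟩ := hv
    simp_rw [show ⇑(charMap k) = char k from rfl, powerSum_homPart_char]
    have : Continuous fun R : ℝ => (R : ℂ) ^ l1 k • charMap k := by fun_prop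
    have h := (this.tendsto 1).mono_left (nhdsWithin_le_nhds (s := Iio 1))
    simpa using h
  | zero => simp [powerSum, homPart, coeff]
  | add v w _ _ hv hw =>
    refine (hv.add hw).congr' ?_
    filter_upwards [hlt] with R hR
    rw [ContinuousMap.coe_add, powerSum_homPart_add (integrable_continuousMap v)
      (integrable_continuousMap w) hR]
  | smul c v _ hv =>
    refine (hv.const_smul c).congr fun R => ?_
    rw [show ⇑(c • v) = fun x => c * v x from rfl, powerSum_homPart_const_mul]

/-- Convergence in `L₁`: uniform convergence for trigonometric polynomials, which are dense, and
boundedness of the Poisson integrals. -/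
theorem tendsto_eLpNorm_powerSum_homPart_sub {d : ℕ} {u : Torus d → ℂ}
    (hu : Integrable u (sigma d)) :
    Tendsto (fun R : ℝ => eLpNorm (⇑(powerSum (homPart u) (R : ℂ)) - u) 1 (sigma d))
      (𝓝[<] 1) (𝓝 0) := by
  have hlt : ∀ᶠ R : ℝ in 𝓝[<] 1, R ∈ Ioo (0 : ℝ) 1 :=
    Ioo_mem_nhdsLT (show (0 : ℝ) < 1 by norm_num)
  rw [ENNReal.tendsto_nhds_zero]
  intro ε hε
  obtain ⟨δ, hδ, hδ0⟩ : ∃ δ : ℝ, (12 ^ d + 2) * ENNReal.ofReal δ ≤ ε ∧ 0 < δ := by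
    have h : Tendsto (fun δ : ℝ => (12 ^ d + 2) * ENNReal.ofReal δ) (𝓝[>] 0) (𝓝 0) := by
      have h := ENNReal.Tendsto.const_mul (a := 12 ^ d + 2) (ENNReal.tendsto_ofReal
        (tendsto_nhdsWithin_of_tendsto_nhds (tendsto_id (x := 𝓝 (0 : ℝ))) (s := Ioi 0)))
        (Or.inr (by finiteness))
      simpa using h
    exact (((ENNReal.tendsto_nhds_zero.1 h) ε hε).and self_mem_nhdsWithin).exists
  obtain ⟨v, hv, huv⟩ := exists_trigPolynomial_integral_norm_sub_lt hu hδ0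
  have hvi := integrable_continuousMap v
  have huv' : eLpNorm (u - ⇑v) 1 (sigma d) ≤ ENNReal.ofReal δ := by
    rw [eLpNorm_one_eq_lintegral_enorm, ← ofReal_integral_norm_eq_lintegral_enorm (hu.sub hvi)]
    exact ENNReal.ofReal_le_ofReal huv.le
  have hvR := (Metric.tendsto_nhds.1 (tendsto_powerSum_homPart_of_mem_span hv)) δ hδ0
  filter_upwards [hlt, hvR] with R hR hvR
  have hRs := ofReal_mem_stolz hR.1.le hR.2
  have hsplit : ⇑(powerSum (homPart u) (R : ℂ)) - u =
      (⇑(powerSum (homPart (u - ⇑v)) (R : ℂ)) + ⇑(powerSum (homPart v) (R : ℂ) - v)) -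
        (u - ⇑v) := by
    rw [homPart_sub hu hvi, powerSum_sub (geomSummable_homPart u) (geomSummable_homPart _)
      (norm_lt_one_of_mem_stolz hRs)]
    ext x
    simp
  have h1 : eLpNorm (⇑(powerSum (homPart (u - ⇑v)) (R : ℂ))) 1 (sigma d) ≤
      12 ^ d * ENNReal.ofReal δ :=
    (eLpNorm_powerSum_homPart_le le_rfl (memLp_one_iff_integrable.2 (hu.sub hvi)) hRs).trans
      (mul_le_mul' le_rfl huv')
  have h2 : eLpNorm (⇑(powerSum (homPart v) (R : ℂ) - v)) 1 (sigma d) ≤ ENNReal.ofReal δ := by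
    refine (eLpNorm_le_of_ae_bound (C := δ) (ae_of_all _ fun x => ?_)).trans (le_of_eq (by simp))
    refine (ContinuousMap.norm_coe_le_norm _ x).trans ?_
    rw [← dist_eq_norm]; exact hvR.le
  rw [hsplit]
  have hm (w : C(Torus d, ℂ)) : AEStronglyMeasurable (⇑w) (sigma d) :=
    w.continuous.aestronglyMeasurable
  refine (eLpNorm_sub_le ((hm _).add (hm _)) (hu.sub hvi).aestronglyMeasurable le_rfl).trans ?_
  refine (add_le_add (eLpNorm_add_le (hm _) (hm _) le_rfl) le_rfl).trans ?_
  refine (add_le_add (add_le_add h1 h2) huv').trans (le_trans (le_of_eq ?_) hδ)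
  ring

/-- Along a suitable sequence `R → 1` the Poisson integrals converge almost everywhere. -/
theorem exists_seq_tendsto_ae_powerSum_homPart {d : ℕ} {u : Torus d → ℂ}
    (hu : Integrable u (sigma d)) :
    ∃ R : ℕ → ℝ, Tendsto R atTop (𝓝[<] 1) ∧
      ∀ᵐ x ∂(sigma d), Tendsto (fun i => powerSum (homPart u) (R i : ℂ) x) atTop (𝓝 (u x)) := by
  obtain ⟨R, hR⟩ := exists_seq_tendsto (𝓝[<] (1 : ℝ))
  have h := tendstoInMeasure_of_tendsto_eLpNorm one_ne_zero
    (fun i => (powerSum (homPart u) (R i : ℂ)).continuous.aestronglyMeasurable)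
    hu.aestronglyMeasurable ((tendsto_eLpNorm_powerSum_homPart_sub hu).comp hR)
  obtain ⟨ns, hns, hae⟩ := h.exists_seq_tendsto_ae
  exact ⟨R ∘ ns, hR.comp hns.tendsto_atTop, hae⟩

/-! ### The Taylor–Abel–Poisson mean as a Taylor polynomial -/

/-- The second formula in the definition of `λ_{ν,r}(ρ)` is valid for `ν < r` as well: the terms
with `j > ν` vanish, and the others add up to `((1 - ρ) + ρ)ᵛ`. -/
theorem lam_eq_sum (ν r : ℕ) (ρ : ℝ) :
    lam ν r ρ = ∑ j ∈ Finset.range r, (ν.choose j : ℝ) * (1 - ρ) ^ j * ρ ^ (ν - j) := by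
  rw [lam]
  split_ifs with h
  · have h1 := add_pow (1 - ρ) ρ ν
    rw [sub_add_cancel, one_pow] at h1
    refine h1.trans ((Finset.sum_congr rfl fun j _ => by ring).trans
      (Finset.sum_subset (Finset.range_subset_range.2 (Nat.succ_le_of_lt h)) fun j _ hj => ?_))
    rw [Nat.choose_eq_zero_of_lt (by simpa using hj)]
    simp
  · rfl

/-- The mean `A_{ρ,r}(f)` is the value at `1` of the Taylor polynomial of degree `r - 1` at `ρ` of
the Poisson integral as a function of the radius. -/
theorem tapMean_eq_sum {d : ℕ} {ρ : ℝ} (h0 : 0 ≤ ρ) (h1 : ρ < 1) (r : ℕ) (f : Torus d → ℂ)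
    (x : Torus d) :
    tapMean ρ r f x = ∑ j ∈ Finset.range r,
      ((1 - ρ : ℂ) ^ j / (j ! : ℂ)) * powerSum (derivCoeff j (homPart f)) (ρ : ℂ) x := by
  have hρ : ‖(ρ : ℂ)‖ < 1 := by rwa [Complex.norm_real, Real.norm_of_nonneg h0]
  have hterm (j : ℕ) : HasSum
      (fun ν => ((ν.choose j : ℂ) * (1 - ρ) ^ j * (ρ : ℂ) ^ (ν - j)) * homPart f ν x)
      (((1 - ρ : ℂ) ^ j / (j ! : ℂ)) * powerSum (derivCoeff j (homPart f)) (ρ : ℂ) x) := by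
    have hs := (((geomSummable_homPart f).derivCoeff j).summable hρ).hasSum
    have hs' : HasSum (fun ν => ((1 - ρ : ℂ) ^ j / (j ! : ℂ)) *
        ((ρ : ℂ) ^ ν • derivCoeff j (homPart f) ν) x)
        (((1 - ρ : ℂ) ^ j / (j ! : ℂ)) * powerSum (derivCoeff j (homPart f)) (ρ : ℂ) x) :=
      ((ContinuousMap.evalCLM ℂ x).hasSum hs).mul_left _
    rw [← hasSum_nat_add_iff' j, Finset.sum_eq_zero, sub_zero]
    · have hj : (j ! : ℂ) ≠ 0 := by exact_mod_cast j.factorial_ne_zero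
      have heq (ν : ℕ) : (((ν + j).choose j : ℂ) * (1 - ρ) ^ j * (ρ : ℂ) ^ (ν + j - j)) *
          homPart f (ν + j) x = ((1 - ρ : ℂ) ^ j / (j ! : ℂ)) *
            ((ρ : ℂ) ^ ν • derivCoeff j (homPart f) ν) x := by
        simp only [ContinuousMap.smul_apply, derivCoeff, smul_eq_mul,
          Nat.descFactorial_eq_factorial_mul_choose, Nat.add_sub_cancel, Nat.cast_mul]
        field_simp
      simpa only [heq] using hs'
    · intro ν hν
      rw [Nat.choose_eq_zero_of_lt (Finset.mem_range.1 hν)]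
      simp
  rw [tapMean, ← (hasSum_sum fun j _ => hterm j).tsum_eq]
  refine tsum_congr fun ν => ?_
  rw [lam_eq_sum, ← Finset.sum_mul]
  push_cast
  simp [homPart]

/-! ### Poisson integrals as functions of the radius with values in `L_p` -/

theorem integral_norm_le_toReal_eLpNorm {d : ℕ} {p : ℝ≥0∞} (hp : 1 ≤ p) {u : Torus d → ℂ}
    (hu : MemLp u p (sigma d)) :
    ∫ x, ‖u x‖ ∂(sigma d) ≤ (eLpNorm u p (sigma d)).toReal := by
  rw [integral_norm_eq_lintegral_enorm hu.1, ← eLpNorm_one_eq_lintegral_enorm]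
  exact ENNReal.toReal_mono hu.2.ne (eLpNorm_le_eLpNorm_of_exponent_le hp hu.1)

theorem norm_coeff_le_toReal_eLpNorm {d : ℕ} {p : ℝ≥0∞} (hp : 1 ≤ p) {u : Torus d → ℂ}
    (hu : MemLp u p (sigma d)) (k : Fin d → ℤ) :
    ‖coeff u k‖ ≤ (eLpNorm u p (sigma d)).toReal :=
  (norm_coeff_le u k).trans (integral_norm_le_toReal_eLpNorm hp hu)

theorem norm_toLp_eq {d : ℕ} {p : ℝ≥0∞} [Fact (1 ≤ p)] (v : C(Torus d, ℂ)) :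
    ‖ContinuousMap.toLp p (sigma d) ℂ v‖ = (eLpNorm v p (sigma d)).toReal := by
  rw [Lp.norm_def, eLpNorm_congr_ae (ContinuousMap.coeFn_toLp (sigma d) v)]

/-- The homogeneous parts of the Fourier series of `u` as elements of `L_p`. -/
def homPartLp {d : ℕ} (p : ℝ≥0∞) [Fact (1 ≤ p)] (u : Torus d → ℂ) (ν : ℕ) :
    Lp ℂ p (sigma d) :=
  ContinuousMap.toLp p (sigma d) ℂ (homPart u ν)

section Lp

variable {d : ℕ} {p : ℝ≥0∞} [Fact (1 ≤ p)]

theorem geomSummable_homPartLp (u : Torus d → ℂ) : GeomSummable (homPartLp p u) := by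
  intro t h0 h1
  refine Summable.of_nonneg_of_le (fun ν => by positivity) (fun ν => ?_)
    ((geomSummable_homPart u t h0 h1).mul_left
      ‖(ContinuousMap.toLp p (sigma d) ℂ : C(Torus d, ℂ) →L[ℂ] Lp ℂ p (sigma d))‖)
  rw [mul_left_comm]
  gcongr
  exact ContinuousLinearMap.le_opNorm _ _

theorem powerSum_derivCoeff_homPartLp (u : Torus d → ℂ) (j : ℕ) {z : ℂ} (hz : ‖z‖ < 1) :
    powerSum (derivCoeff j (homPartLp p u)) z =
      ContinuousMap.toLp p (sigma d) ℂ (powerSum (derivCoeff j (homPart u)) z) := by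
  rw [map_powerSum _ ((geomSummable_homPart u).derivCoeff j) hz]
  simp only [derivCoeff, map_smul]
  rfl

theorem powerSum_homPartLp (u : Torus d → ℂ) {z : ℂ} (hz : ‖z‖ < 1) :
    powerSum (homPartLp p u) z = ContinuousMap.toLp p (sigma d) ℂ (powerSum (homPart u) z) := by
  simpa only [derivCoeff_zero] using powerSum_derivCoeff_homPartLp (p := p) u 0 hz

theorem norm_powerSum_homPartLp_le {u : Torus d → ℂ} (hu : MemLp u p (sigma d)) {z : ℂ}
    (hz : z ∈ stolz) :
    ‖powerSum (homPartLp p u) z‖ ≤ 12 ^ d * (eLpNorm u p (sigma d)).toReal := by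
  rw [powerSum_homPartLp u (norm_lt_one_of_mem_stolz hz), norm_toLp_eq]
  have h := eLpNorm_powerSum_homPart_le Fact.out hu hz
  have := ENNReal.toReal_mono (ENNReal.mul_ne_top (by finiteness) hu.2.ne) h
  simpa using this

theorem homPartLp_sub {u v : Torus d → ℂ} (hu : Integrable u (sigma d))
    (hv : Integrable v (sigma d)) :
    homPartLp p (u - v) = homPartLp p u - homPartLp p v := by
  ext1 ν
  simp only [homPartLp, homPart_sub hu hv, Pi.sub_apply, map_sub]

end Lp

/-! ### Radial derivatives and the `K`-functional -/

theorem IsRadialDeriv.coeff_eq {d m : ℕ} {f g : Torus d → ℂ} (h : IsRadialDeriv m f g)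
    (k : Fin d → ℤ) : coeff g k = (((l1 k).descFactorial m : ℕ) : ℂ) * coeff f k := by
  rw [h.2.2 k]
  split_ifs with hk
  · simp [Nat.descFactorial_eq_zero_iff_lt.2 hk]
  · have h1 := Nat.factorial_mul_descFactorial (not_lt.1 hk)
    have h2 : ((l1 k - m)! : ℂ) ≠ 0 := by exact_mod_cast Nat.factorial_ne_zero _
    rw [← h1]
    push_cast
    field_simp

theorem IsRadialDeriv.homPartLp_eq {d m : ℕ} {p : ℝ≥0∞} [Fact (1 ≤ p)] {f g : Torus d → ℂ}
    (h : IsRadialDeriv m f g) (ν : ℕ) :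
    homPartLp p g ν = ((ν.descFactorial m : ℕ) : ℂ) • homPartLp p f ν := by
  rw [homPartLp, homPartLp, ← map_smul]
  congr 1
  rw [homPart, homPart, Finset.smul_sum]
  refine Finset.sum_congr rfl fun k hk => ?_
  rw [smul_smul, h.coeff_eq, (mem_sphere k).1 hk]

/-- A majorant is positive on `(0, 1]`, being monotone with limit `0` at `0` and without zeros. -/
theorem IsMajorant.pos {ω : ℝ → ℝ} (hω : IsMajorant ω) {t : ℝ} (h0 : 0 < t) (h1 : t ≤ 1) :
    0 < ω t := by
  refine lt_of_le_of_ne ?_ (hω.ne_zero t ⟨h0, h1⟩).symm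
  refine le_of_tendsto hω.tendsto_zero ?_
  filter_upwards [Ioo_mem_nhdsGT h0] with s hs
  exact hω.monotoneOn ⟨hs.1.le, hs.2.le.trans h1⟩ ⟨h0.le, h1⟩ hs.2.le

/-- Near-minimizers in the `K`-functional. -/
theorem exists_of_kFunctional_lt {d n : ℕ} {p : ℝ≥0∞} {δ κ : ℝ} (hδ : 0 ≤ δ) {g : Torus d → ℂ}
    (h : kFunctional n δ g p < ENNReal.ofReal κ) (hg : MemLp g p (sigma d)) :
    ∃ u G : Torus d → ℂ, MemLp u p (sigma d) ∧ IsRadialDeriv n u G ∧ MemLp G p (sigma d) ∧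
      (eLpNorm (g - u) p (sigma d)).toReal + δ ^ n * (eLpNorm G p (sigma d)).toReal ≤ κ := by
  simp only [kFunctional, iInf_lt_iff] at h
  obtain ⟨u, G, hu, huG, hG, hlt⟩ := h
  refine ⟨u, G, hu, huG, hG, ?_⟩
  have hκ : 0 ≤ κ := by
    by_contra hneg
    rw [ENNReal.ofReal_of_nonpos (le_of_not_ge hneg)] at hlt
    exact not_lt_bot hlt
  have h1 := ENNReal.toReal_mono ENNReal.ofReal_ne_top hlt.le
  rwa [ENNReal.toReal_add (hg.sub hu).2.ne (ENNReal.mul_ne_top ENNReal.ofReal_ne_top hG.2.ne),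
    ENNReal.toReal_mul, ENNReal.toReal_ofReal (by positivity), ENNReal.toReal_ofReal hκ] at h1

/-- If `g` has a nonzero Fourier coefficient of order at least `n`, then its `K`-functional of
order `n` is at least of the size `δⁿ`. -/
theorem pow_mul_norm_coeff_le {d n : ℕ} {p : ℝ≥0∞} (hp : 1 ≤ p) {δ κ : ℝ} (hδ : 0 ≤ δ)
    (hδ1 : δ ≤ 1) {g u G : Torus d → ℂ} (hg : MemLp g p (sigma d)) (hu : MemLp u p (sigma d))
    (huG : IsRadialDeriv n u G) (hG : MemLp G p (sigma d))
    (h : (eLpNorm (g - u) p (sigma d)).toReal + δ ^ n * (eLpNorm G p (sigma d)).toReal ≤ κ)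
    {k : Fin d → ℤ} (hk : n ≤ l1 k) : δ ^ n * ‖coeff g k‖ ≤ κ := by
  have h1 : ‖coeff g k‖ ≤ ‖coeff (g - u) k‖ + ‖coeff u k‖ := by
    rw [coeff_sub (hg.integrable hp) (hu.integrable hp)]
    simpa using norm_add_le (coeff g k - coeff u k) (coeff u k)
  have h2 : ‖coeff u k‖ ≤ ‖coeff G k‖ := by
    rw [huG.coeff_eq, norm_mul, Complex.norm_natCast]
    have : 1 ≤ (l1 k).descFactorial n := Nat.descFactorial_pos.2 hk
    exact le_mul_of_one_le_left (norm_nonneg _) (by exact_mod_cast this)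
  have h3 := norm_coeff_le_toReal_eLpNorm hp (hg.sub hu) k
  have h4 := norm_coeff_le_toReal_eLpNorm hp hG k
  have h5 : δ ^ n ≤ 1 := pow_le_one₀ hδ hδ1
  have h6 : 0 ≤ δ ^ n := by positivity
  calc δ ^ n * ‖coeff g k‖ ≤ δ ^ n * ((eLpNorm (g - u) p (sigma d)).toReal +
        (eLpNorm G p (sigma d)).toReal) := by gcongr; linarith
    _ ≤ (eLpNorm (g - u) p (sigma d)).toReal + δ ^ n * (eLpNorm G p (sigma d)).toReal := by
        rw [mul_add]
        gcongr
        exact mul_le_of_le_one_left ENNReal.toReal_nonneg h5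
    _ ≤ κ := h

theorem tendsto_one_sub_nhdsLT : Tendsto (fun ζ : ℝ => 1 - ζ) (𝓝[<] 1) (𝓝[>] 0) := by
  refine tendsto_nhdsWithin_of_tendsto_nhds_of_eventually_within _ ?_ ?_
  · have : Continuous fun ζ : ℝ => 1 - ζ := by fun_prop
    simpa using (this.tendsto 1).mono_left (nhdsWithin_le_nhds (s := Iio 1))
  · filter_upwards [self_mem_nhdsWithin] with ζ hζ
    simpa using hζ

/-- Growth of the `r`-th derivative of the Poisson integral in the radius. If `f^{[r-n]}` has
Fourier coefficients only of order less than `n`, that derivative vanishes; otherwise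
`δⁿ = O(ω(δ))`, and the terms in which only `‖f^{[r-n]}‖` is available are harmless. -/
theorem exists_eventually_norm_powerSum_derivCoeff_le {d : ℕ} {p : ℝ≥0∞} [Fact (1 ≤ p)]
    {n r : ℕ} (hnr : n ≤ r) {ω : ℝ → ℝ} (hω : IsMajorant ω) {f g : Torus d → ℂ}
    (hfg : IsRadialDeriv (r - n) f g) (hg : MemLp g p (sigma d))
    (hK : ∃ C : ℝ, ∀ᶠ δ in 𝓝[>] (0 : ℝ),
      kFunctional n δ g p ≤ ENNReal.ofReal (C * ω δ)) :
    ∃ C : ℝ, 0 ≤ C ∧ ∀ᶠ ζ : ℝ in 𝓝[<] 1,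
      ‖powerSum (derivCoeff r (homPartLp p f)) (ζ : ℂ)‖ ≤ C * (ω (1 - ζ) / (1 - ζ) ^ n) := by
  have hp : 1 ≤ p := Fact.out
  by_cases hcase : ∃ k, n ≤ l1 k ∧ coeff g k ≠ 0
  swap
  · push Not at hcase
    have hzero : derivCoeff r (homPartLp p f) = 0 := by
      ext1 ν
      have : homPart f (ν + r) = 0 := by
        refine Finset.sum_eq_zero fun k hk => ?_
        have hk' := (mem_sphere k).1 hk
        have h1 := hcase k (by omega)
        rw [hfg.coeff_eq, mul_eq_zero, Nat.cast_eq_zero, Nat.descFactorial_eq_zero_iff_lt] at h1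
        rw [h1.resolve_left (by omega), zero_smul]
      simp [derivCoeff, homPartLp, this]
    refine ⟨0, le_rfl, Eventually.of_forall fun ζ => ?_⟩
    simp [hzero, powerSum]
  obtain ⟨k, hk, hgk⟩ := hcase
  obtain ⟨C, hC⟩ := hK
  obtain ⟨A, hA0, hA⟩ := exists_norm_powerSum_derivCoeff_le (E := Lp ℂ p (sigma d)) (r - n) n
  set γ := ‖coeff g k‖
  have hγ0 : 0 < γ := norm_pos_iff.2 hgk
  set N := (eLpNorm g p (sigma d)).toReal with hN
  have hN0 : 0 ≤ N := ENNReal.toReal_nonneg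
  -- The summand `1` makes the bound on the `K`-functional strict.
  set B := max C 0 + 1
  have hB0 : 0 < B := by positivity
  refine ⟨A * 12 ^ d * (3 + N / γ) * B, by positivity, ?_⟩
  filter_upwards [tendsto_one_sub_nhdsLT.eventually hC,
    Ico_mem_nhdsLT (show (1 / 2 : ℝ) < 1 by norm_num)] with ζ hζ hζI
  set δ := 1 - ζ with hδ
  have hδ0 : 0 < δ := by linarith [hζI.2]
  have hδ1 : δ ≤ 1 := by linarith [hζI.1]
  have hωδ := hω.pos hδ0 hδ1
  have hlt : kFunctional n δ g p < ENNReal.ofReal (B * ω δ) := by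
    refine hζ.trans_lt ((ENNReal.ofReal_lt_ofReal_iff (by positivity)).2 ?_)
    have : C ≤ max C 0 := le_max_left _ _
    exact mul_lt_mul_of_pos_right (by linarith) hωδ
  obtain ⟨u, G, hu, huG, hG, hle⟩ := exists_of_kFunctional_lt hδ0.le hlt hg
  have hγle := pow_mul_norm_coeff_le hp hδ0.le hδ1 hg hu huG hG hle hk
  have hgi := hg.integrable hp
  have hui := hu.integrable hp
  have hmain := hA (homPartLp p f) (homPartLp p g) (homPartLp p u) (homPartLp p G)
    (geomSummable_homPartLp f) (geomSummable_homPartLp g) (geomSummable_homPartLp u)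
    hfg.homPartLp_eq huG.homPartLp_eq _ _ _
    (fun z hz => by
      rw [← homPartLp_sub hgi hui]; exact norm_powerSum_homPartLp_le (hg.sub hu) hz)
    (fun z hz => norm_powerSum_homPartLp_le hu hz)
    (fun z hz => norm_powerSum_homPartLp_le hG hz) ζ hζI.1 hζI.2
  rw [Nat.sub_add_cancel hnr, ← hδ] at hmain
  refine hmain.trans ?_
  set a := (eLpNorm (g - u) p (sigma d)).toReal with ha
  set b := (eLpNorm G p (sigma d)).toReal with hb
  have ha0 : 0 ≤ a := ENNReal.toReal_nonneg
  have hb0 : 0 ≤ b := ENNReal.toReal_nonneg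
  have hun : (eLpNorm u p (sigma d)).toReal ≤ N + a := by
    have h1 : eLpNorm u p (sigma d) ≤ eLpNorm g p (sigma d) + eLpNorm (g - u) p (sigma d) := by
      have := eLpNorm_sub_le hg.1 (hg.sub hu).1 hp
      simpa using this
    have h2 := ENNReal.toReal_mono (ENNReal.add_ne_top.2 ⟨hg.2.ne, (hg.sub hu).2.ne⟩) h1
    rwa [ENNReal.toReal_add hg.2.ne (hg.sub hu).2.ne] at h2
  have hδn : 0 < δ ^ n := by positivity
  have hδn1 : δ ^ n ≤ 1 := pow_le_one₀ hδ0.le hδ1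
  set W := B * ω δ / δ ^ n with hW
  have hWle : B * ω δ ≤ W := le_div_self (by positivity) hδn hδn1
  have hW1 : a / δ ^ n ≤ W := by
    rw [hW]; gcongr
    have : 0 ≤ δ ^ n * b := by positivity
    linarith
  have hW2 : a ≤ W := by
    have : 0 ≤ δ ^ n * b := by positivity
    linarith
  have hW3 : b ≤ W := by
    rw [hW, le_div_iff₀ hδn]; linarith
  -- The size of `‖g‖` is compared with `W` through the nonzero coefficient.
  have hW4 : N ≤ N / γ * W := by
    have : γ ≤ W := by rw [hW, le_div_iff₀ hδn]; linarith
    calc N = N / γ * γ := by field_simp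
      _ ≤ _ := by gcongr
  calc _ = A * 12 ^ d * (a / δ ^ n + (eLpNorm u p (sigma d)).toReal + b) := by ring
    _ ≤ A * 12 ^ d * ((3 + N / γ) * W) := by
        gcongr
        linarith
    _ = _ := by rw [hW]; ring

/-! ### The remainder of Taylor's formula -/

/-- Taylor's formula with integral remainder on `[ρ, R]`, combined with a bound
`C ω(1 - ζ) / (1 - ζ)ⁿ` for the derivative of order `r`. -/
theorem norm_powerSum_sub_taylor_le {E : Type*} [NormedAddCommGroup E] [NormedSpace ℂ E]
    [CompleteSpace E] {b : ℕ → E} (hb : GeomSummable b) {n r : ℕ} (hn : 1 ≤ n) (hnr : n ≤ r)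
    {ω : ℝ → ℝ} {C ρ R : ℝ} (hC : 0 ≤ C) (h0 : 0 ≤ ρ) (hρR : ρ < R) (hR : R < 1)
    (hω : ∀ t ∈ Ioc 0 (1 - ρ), 0 ≤ ω t)
    (hint : IntegrableOn (fun t => ω t / t) (Ioc 0 (1 - ρ)))
    (hbd : ∀ ζ ∈ Ico ρ 1,
      ‖powerSum (derivCoeff r b) (ζ : ℂ)‖ ≤ C * (ω (1 - ζ) / (1 - ζ) ^ n)) :
    ‖powerSum b (R : ℂ) - ∑ j ∈ Finset.range r,
        ((R - ρ : ℂ) ^ j / (j ! : ℂ)) • powerSum (derivCoeff j b) (ρ : ℂ)‖ ≤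
      C * (1 - ρ) ^ (r - n) * ∫ t in Ioc 0 (1 - ρ), ω t / t := by
  obtain ⟨q, rfl⟩ : ∃ q, r = q + 1 := ⟨r - 1, by omega⟩
  set ψ : ℝ → E := fun t => ∑ j ∈ Finset.range (q + 1),
    ((R - t : ℂ) ^ j / (j ! : ℂ)) • powerSum (derivCoeff j b) (t : ℂ) with hψ
  set ψ' : ℝ → E := fun t =>
    ((R - t : ℂ) ^ q / (q ! : ℂ)) • powerSum (derivCoeff (q + 1) b) (t : ℂ) with hψ'
  have hder : ∀ t ∈ uIcc ρ R, HasDerivAt ψ (ψ' t) t := by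
    intro t ht
    rw [uIcc_of_le hρR.le] at ht
    exact hasDerivAt_taylor_powerSum hb q R (h0.trans ht.1) (ht.2.trans_lt hR)
  have hcont : ContinuousOn ψ' (uIcc ρ R) := by
    intro t ht
    rw [uIcc_of_le hρR.le] at ht
    have hz : ‖(t : ℂ)‖ < 1 := by
      rw [Complex.norm_real, Real.norm_of_nonneg (h0.trans ht.1)]; exact ht.2.trans_lt hR
    refine ContinuousAt.continuousWithinAt (ContinuousAt.smul (by fun_prop) ?_)
    exact ContinuousAt.comp (f := fun t : ℝ => (t : ℂ))
      (hasDerivAt_powerSum_derivCoeff hb (q + 1) hz).continuousAt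
      Complex.continuous_ofReal.continuousAt
  have hftc := intervalIntegral.integral_eq_sub_of_hasDerivAt hder hcont.intervalIntegrable
  -- At the base point `R` only the term `j = 0` of the Taylor polynomial survives.
  have hψR : ψ R = powerSum b (R : ℂ) := by
    simp only [hψ]
    rw [Finset.sum_range_succ', Finset.sum_eq_zero]
    · simp [derivCoeff_zero]
    · intro j _; simp
  have hsubset : Ioc (1 - R) (1 - ρ) ⊆ Ioc 0 (1 - ρ) := Ioc_subset_Ioc_left (by linarith)
  have hint' : IntervalIntegrable (fun t => ω t / t) volume (1 - R) (1 - ρ) :=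
    (intervalIntegrable_iff_integrableOn_Ioc_of_le (by linarith)).2 (hint.mono_set hsubset)
  have hint'' : IntervalIntegrable (fun t => ω (1 - t) / (1 - t)) volume ρ R := by
    have := hint'.comp_sub_left 1
    simp only [sub_sub_cancel] at this
    exact this.symm
  have hle : ‖∫ t in ρ..R, ψ' t‖ ≤
      ∫ t in ρ..R, C * (1 - ρ) ^ (q + 1 - n) * (ω (1 - t) / (1 - t)) := by
    refine intervalIntegral.norm_integral_le_of_norm_le hρR.le (ae_of_all _ fun t ht => ?_)
      (hint''.const_mul _)
    have ht1 : 0 < 1 - t := by linarith [ht.2]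
    have hωt : 0 ≤ ω (1 - t) := hω _ ⟨ht1, by linarith [ht.1]⟩
    -- `(1 - t)^{r - 1} / (1 - t)ⁿ = (1 - t)^{r - n} / (1 - t)`, with `r = q + 1`.
    have e1 : ‖((R - t : ℂ) ^ q / (q ! : ℂ))‖ ≤ (1 - t) ^ q := by
      rw [norm_div, norm_pow, Complex.norm_natCast, ← Complex.ofReal_sub, Complex.norm_real,
        Real.norm_of_nonneg (by linarith [ht.2])]
      have : (1 : ℝ) ≤ q ! := by exact_mod_cast Nat.one_le_iff_ne_zero.2 q.factorial_ne_zero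
      refine (div_le_self (pow_nonneg (by linarith [ht.2]) _) this).trans ?_
      exact pow_le_pow_left₀ (by linarith [ht.2]) (by linarith) q
    have e2 := hbd t ⟨ht.1.le, ht.2.trans_lt hR⟩
    rw [hψ', norm_smul]
    refine (mul_le_mul e1 e2 (norm_nonneg _) (by positivity)).trans ?_
    have e3 : (1 - t) ^ (q + 1 - n) ≤ (1 - ρ) ^ (q + 1 - n) :=
      pow_le_pow_left₀ ht1.le (by linarith [ht.1]) _
    have e4 : (1 - t) ^ q = (1 - t) ^ (q + 1 - n) * (1 - t) ^ (n - 1) := by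
      rw [← pow_add]; congr 1; omega
    have e5 : (1 - t) ^ n = (1 - t) ^ (n - 1) * (1 - t) := by
      rw [← pow_succ]; congr 1; omega
    calc (1 - t) ^ q * (C * (ω (1 - t) / (1 - t) ^ n))
        = C * (1 - t) ^ (q + 1 - n) * (ω (1 - t) / (1 - t)) := by
          rw [e4, e5]
          have : (1 - t) ^ (n - 1) ≠ 0 := pow_ne_zero _ ht1.ne'
          field_simp
      _ ≤ _ := by gcongr
  rw [intervalIntegral.integral_const_mul,
    intervalIntegral.integral_comp_sub_left (fun t => ω t / t) 1,
    intervalIntegral.integral_of_le (a := 1 - R) (by linarith)] at hle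
  have hmono : ∫ t in Ioc (1 - R) (1 - ρ), ω t / t ≤ ∫ t in Ioc 0 (1 - ρ), ω t / t := by
    refine setIntegral_mono_set hint ?_ (ae_of_all _ hsubset)
    filter_upwards [ae_restrict_mem measurableSet_Ioc] with t ht
    exact div_nonneg (hω t ht) ht.1.le
  rw [hftc, hψR] at hle
  refine hle.trans ?_
  have : 0 ≤ C * (1 - ρ) ^ (q + 1 - n) := by
    have : 0 ≤ 1 - ρ := by linarith
    positivity
  gcongr

end TaylorAbelPoisson

end

open TaylorAbelPoisson in
theorem theorem1 (d : ℕ) (p : ℝ≥0∞) (hp : 1 ≤ p) (n r : ℕ) (hn : 1 ≤ n) (hnr : n ≤ r)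
    (ω : ℝ → ℝ) (hω : TaylorAbelPoisson.IsMajorant ω)
    (hZ : TaylorAbelPoisson.ZygmundCondition ω)
    (f : TaylorAbelPoisson.Torus d → ℂ) (hf : TaylorAbelPoisson.MemLpY f p)
    -- `g` is the radial derivative of order `r - n` of `f`
    (g : TaylorAbelPoisson.Torus d → ℂ) (hfg : TaylorAbelPoisson.IsRadialDeriv (r - n) f g)
    (hg : MemLp g p (TaylorAbelPoisson.sigma d))
    (hK : ∃ C : ℝ, ∀ᶠ δ in 𝓝[>] (0 : ℝ),
      TaylorAbelPoisson.kFunctional n δ g p ≤ ENNReal.ofReal (C * ω δ)) :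
    ∃ C : ℝ, ∀ᶠ ρ in 𝓝[<] (1 : ℝ),
      eLpNorm (f - TaylorAbelPoisson.tapMean ρ r f) p (TaylorAbelPoisson.sigma d) ≤
        ENNReal.ofReal (C * ((1 - ρ) ^ (r - n) * ω (1 - ρ))) := by
  have : Fact (1 ≤ p) := ⟨hp⟩
  obtain ⟨C, hC0, hC⟩ := exists_eventually_norm_powerSum_derivCoeff_le hnr hω hfg hg hK
  obtain ⟨Z, hZ0, hZb⟩ := hZ.2.exists_nonneg
  obtain ⟨t₀, ht₀, ht₀C⟩ := (mem_nhdsLT_iff_exists_Ico_subset).1 hC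
  refine ⟨C * Z, ?_⟩
  filter_upwards [tendsto_one_sub_nhdsLT.eventually hZ.1,
    tendsto_one_sub_nhdsLT.eventually hZb.bound, Ico_mem_nhdsLT (show (0 : ℝ) < 1 by norm_num),
    Ico_mem_nhdsLT ht₀] with ρ hρi hρZ hρ01 hρt
  have hωpos : ∀ t ∈ Ioc 0 (1 - ρ), 0 ≤ ω t := fun t ht =>
    (hω.pos ht.1 (by linarith [ht.2, hρ01.1])).le
  have h1ρ : 0 < 1 - ρ := by linarith [hρ01.2]
  have hωρ := hω.pos h1ρ (by linarith [hρ01.1])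
  rw [Real.norm_of_nonneg hωρ.le] at hρZ
  have hρZ' := (Real.le_norm_self _).trans hρZ
  have hρn : ‖(ρ : ℂ)‖ < 1 := by
    rw [Complex.norm_real, Real.norm_of_nonneg hρ01.1]; exact hρ01.2
  -- The Taylor remainder at a radius `R < 1`, a continuous function on the torus.
  set Φ : ℝ → C(Torus d, ℂ) := fun R => powerSum (homPart f) (R : ℂ) -
    ∑ j ∈ Finset.range r,
      ((R - ρ : ℂ) ^ j / (j ! : ℂ)) • powerSum (derivCoeff j (homPart f)) (ρ : ℂ) with hΦ
  have hbound : ∀ R ∈ Ioo ρ 1, eLpNorm (Φ R) p (sigma d) ≤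
      ENNReal.ofReal (C * Z * ((1 - ρ) ^ (r - n) * ω (1 - ρ))) := by
    intro R hR
    have hRn : ‖(R : ℂ)‖ < 1 := by
      rw [Complex.norm_real, Real.norm_of_nonneg (hρ01.1.trans hR.1.le)]; exact hR.2
    have h := norm_powerSum_sub_taylor_le (geomSummable_homPartLp (p := p) f) hn hnr hC0 hρ01.1
      hR.1 hR.2 hωpos hρi (fun ζ hζ => ht₀C ⟨hρt.1.trans hζ.1, hζ.2⟩)
    rw [powerSum_homPartLp f hRn] at h
    simp_rw [powerSum_derivCoeff_homPartLp f _ hρn, ← map_smul] at h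
    rw [← map_sum, ← map_sub, norm_toLp_eq] at h
    have hfin : eLpNorm (Φ R) p (sigma d) ≠ ∞ := by
      rw [← eLpNorm_congr_ae (ContinuousMap.coeFn_toLp (p := p) (𝕜 := ℂ) (sigma d) (Φ R))]
      exact Lp.eLpNorm_ne_top _
    rw [← ENNReal.ofReal_toReal hfin]
    refine ENNReal.ofReal_le_ofReal (h.trans ?_)
    have : 0 ≤ C * (1 - ρ) ^ (r - n) := by positivity
    calc _ ≤ C * (1 - ρ) ^ (r - n) * (Z * ω (1 - ρ)) := by gcongr
      _ = _ := by ring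
  -- Fatou's lemma along a sequence of radii for which the Poisson integrals converge to `f`.
  obtain ⟨R, hR, hRae⟩ := exists_seq_tendsto_ae_powerSum_homPart (hf.1.integrable hp)
  have hRmem : ∀ᶠ i in atTop, R i ∈ Ioo ρ 1 := hR.eventually (Ioo_mem_nhdsLT hρ01.2)
  refine Lp.eLpNorm_le_of_ae_tendsto (u := atTop) (f := fun i => ⇑(Φ (R i)))
    (hRmem.mono fun i hi => hbound _ hi)
    (fun i => (Φ (R i)).continuous.aestronglyMeasurable) ?_
  filter_upwards [hRae] with x hx
  rw [Pi.sub_apply, tapMean_eq_sum hρ01.1 hρ01.2]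
  have hR1 : Tendsto (fun i => (R i : ℂ)) atTop (𝓝 1) := by
    have := (Complex.continuous_ofReal.tendsto 1).comp (tendsto_nhds_of_tendsto_nhdsWithin hR)
    simpa [Function.comp_def] using this
  simp only [hΦ, ContinuousMap.sub_apply, ContinuousMap.sum_apply, ContinuousMap.smul_apply,
    smul_eq_mul]
  refine hx.sub (tendsto_finsetSum _ fun j _ => ?_)
  exact (((hR1.sub_const (ρ : ℂ)).pow j).div_const _).mul_const _
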